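/- **Setting.** There are $n$ agents. A type is a pair $(x,z)$ with a publicly known part $x\in\{0,1\}^d$ and a self-reported part $z\in\{0,1\}^s$; the types of the agents are drawn independently from the uniform distribution $D$ on $\{0,1\}^d\times\{0,1\}^s$. Agent $i$ with true type $a_i=(x_i,z_i)$ reports some $a_i'=(x_i,z_i')$. Given a score function $f:\{0,1\}^d\times\{0,1\}^s\to\mathbb N$ and a profile of reports $A'=(a_1',\dots,a_n')$, the $k$ agents with the highest scores receive a resource, ties being broken uniformly at random; $\alpha_i(A')$ is the probability that agent $i$ is among them. An audit policy with budget $B$ assigns to every profile $A'$ probabilities $\phi_i(A')\in[0,1]$ with $\sum_i\phi_i(A')\le B$. An agent who lied and is audited loses the resource and pays a fine $c$. So, if all other agents are truthful, agent $i$ of type $a$ has expected utility $\mathbb E_{A_{-i}}[\alpha_i(a,A_{-i})]$ from reporting truthfully, and $\mathbb E_{A_{-i}}[\alpha_i(A')(1-\phi_i(A'))-c\,\phi_i(A')]$, where $A'=(a',A_{-i})$, from reporting $a'\ne a$. The policy is $\varepsilon$-BNIC (Bayes–Nash incentive compatible) if no agent of any type gains more than $\varepsilon$ by misreporting the self-reported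 part, and it is *optimal* if it is $\varepsilon$-BNIC for the smallest $\varepsilon$ for which an $\varepsilon$-BNIC policy with budget $B$ exists. A report $(x,z')$ is *suspicious* if a lowest-scoring type $(x,z^*)$ with the same known part has a strictly smaller expected allocation $\mathbb E_{A_{-i}}[\alpha_i]$, absent audits, than $(x,z')$; otherwise it is a *sure-truth* (under the uniform distribution no report is a sure-lie). **Problem.** An instance consists of $d$, $s$, $k$ and a time bound $t$ (in unary), a program that computes $f$ within $t$ steps (from the bits of $(x,z)$, with the score output in binary), non-negative rationals $B$, $c$ (in binary), and a profile of reports $A'$. The task is to determine which agents should be audited: output the set $\{i:\phi_i(A')>0\}$ for some (any) optimal audit policy $\phi$. **Theorem.** In the top-$k$ allocation setting, determining which agents should be audited is NP-hard, even for $n=4$ agents, a monotone score function $f$, the uniform distribution $D$, and when sure-truths can be identified in constant time. Precisely: there are a program $T$ and a constant $C$ such that the problem is NP-hard when restricted to the instances with $n=4$ and $1\le k\le n$ whose $f$ is monotone (in the coordinatewise order of all features) and on which $T$, run on $(x,z')$, decides in at most $C$ steps whether the report $(x,z')$ is a sure-truth. Here NP-hardness of this search problem means that each language $L$ in NP reduces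 to it in polynomial time with one query: an input $w$ is mapped in polynomial time to an instance $J_w$ of the restricted class that has a solution, and from $w$ and an arbitrary solution of $J_w$ one can decide in polynomial time whether $w\in L$. -/

import Mathlib

/-! ### Programs with a step count -/

/-- While programs that work on stacks of bits `0, 1, 2, …` (a program mentions only finitely many of
them, so it is a multi-tape machine each of whose tapes is a stack). -/
inductive StackProg : Type
  /-- Do nothing. -/
  | skip : StackProg
  /-- Push the bit `b` on stack `r`. -/
  | push (r : ℕ) (b : Bool) : StackProg
  /-- Remove the top bit of stack `r` (no effect on an empty stack). -/
  | pop (r : ℕ) : StackProg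
  /-- First `p`, then `q`. -/
  | seq (p q : StackProg) : StackProg
  /-- Run `p`, `q` or `e` according to whether the top bit of stack `r` is `true`, is `false`, or
  does not exist. -/
  | test (r : ℕ) (p q e : StackProg) : StackProg
  /-- While stack `r` is non-empty, run `p`. -/
  | loop (r : ℕ) (p : StackProg) : StackProg

namespace StackProg

/-- The contents of the stacks; the head of a list is the top of the stack. -/
abbrev Store : Type := ℕ → List Bool

/-- A configuration: the programs still to be run, in order, and the contents of the stacks. It is
halted when no program is left. -/
abbrev Config : Type := List StackProg × Store

/-- One elementary step. -/
def step : Config → Config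
  | ([], σ) => ([], σ)
  | (skip :: κ, σ) => (κ, σ)
  | (push r b :: κ, σ) => (κ, Function.update σ r (b :: σ r))
  | (pop r :: κ, σ) => (κ, Function.update σ r (σ r).tail)
  | (seq p q :: κ, σ) => (p :: q :: κ, σ)
  | (test r p q e :: κ, σ) =>
      match σ r with
      | true :: _ => (p :: κ, σ)
      | false :: _ => (q :: κ, σ)
      | [] => (e :: κ, σ)
  | (loop r p :: κ, σ) =>
      match σ r with
      | [] => (κ, σ)
      | _ :: _ => (p :: loop r p :: κ, σ)

/-- The initial configuration: the `j`-th input is on stack `j`, all other stacks are empty. -/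
def start (p : StackProg) (inputs : List (List Bool)) : Config :=
  ([p], fun j => inputs.getD j [])

/-- Started on `inputs`, the program halts after at most `T` steps with `out` on stack `0`. -/
def HaltsWith (p : StackProg) (inputs : List (List Bool)) (T : ℕ) (out : List Bool) : Prop :=
  ∃ t ≤ T, (step^[t] (p.start inputs)).1 = [] ∧ (step^[t] (p.start inputs)).2 0 = out

/-- Started on `inputs`, the program halts after at most `T` steps with the bit `b` on top of
stack `0`. -/
def Answers (p : StackProg) (inputs : List (List Bool)) (T : ℕ) (b : Bool) : Prop :=
  ∃ t ≤ T, (step^[t] (p.start inputs)).1 = [] ∧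
    ((step^[t] (p.start inputs)).2 0).head? = some b

end StackProg

/-! ### Polynomial time, NP, NP-hardness -/

/-- `g` is computable in polynomial time. -/
def PolyTimeComputable (g : List Bool → List Bool) : Prop :=
  ∃ (p : StackProg) (q : Polynomial ℕ), ∀ x, p.HaltsWith [x] (q.eval x.length) (g x)

/-- The binary predicate `V` on strings is decidable in polynomial time. -/
def PolyTimeDecidable₂ (V : List Bool → List Bool → Bool) : Prop :=
  ∃ (p : StackProg) (q : Polynomial ℕ),
    ∀ x w, p.Answers [x, w] (q.eval (x.length + w.length)) (V x w)

/-- The class NP: membership has certificates of polynomial length, checked in polynomial time. -/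
def InNP (L : Set (List Bool)) : Prop :=
  ∃ (V : List Bool → List Bool → Bool) (m : Polynomial ℕ), PolyTimeDecidable₂ V ∧
    ∀ x, x ∈ L ↔ ∃ w : List Bool, w.length ≤ m.eval x.length ∧ V x w = true

/-- A search problem on a restricted class of instances: given an instance in the class, find one
(any one) of its solutions. -/
structure SearchProblem (I : Type) where
  /-- How instances are written down as strings. -/
  encode : I → List Bool
  encode_injective : Function.Injective encode
  /-- The class of instances that the problem is restricted to. -/
  Admissible : I → Prop
  /-- `IsSolution a y`: the string `y` is a correct answer to `a`. -/
  IsSolution : I → List Bool → Prop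

/-- NP-hardness of a search problem. Each language `L` in NP reduces to it in polynomial time with a
single query: `x` is mapped to an admissible instance `g x` that has a solution, and from `x` and any
solution of `g x` whatsoever it can be decided in polynomial time whether `x ∈ L`. -/
def SearchProblem.IsNPHard {I : Type} (P : SearchProblem I) : Prop :=
  ∀ L : Set (List Bool), InNP L →
    ∃ (g : List Bool → I) (V : List Bool → List Bool → Bool),
      PolyTimeComputable (fun x => P.encode (g x)) ∧ PolyTimeDecidable₂ V ∧
      ∀ x, P.Admissible (g x) ∧ (∃ y, P.IsSolution (g x) y) ∧
        ∀ y, P.IsSolution (g x) y → (V x y = true ↔ x ∈ L)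

/-! ### Auditing under top-`k` allocation -/

/-- The data of the audit problem under top-`k` allocation. A type is a pair `(x, z)` of a known part
`x : X` and a self-reported part `z : Z`; the types of the agents are drawn independently from `D`. -/
structure AuditGame (X Z : Type) where
  /-- The distribution of types; its mass function is the `h` of the usual notation. -/
  D : PMF (X × Z)
  /-- The score function. -/
  f : X × Z → ℝ
  /-- The number of resources. -/
  k : ℕ
  /-- The audit budget. -/
  B : ℝ
  /-- The fine paid by an agent who is caught lying. -/
  c : ℝ

namespace AuditGame

variable {X Z : Type} {n : ℕ}

/-- The probability `α_i` with which agent `i` receives one of the `k` resources when they go to the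
`k` highest-scoring reports of the profile `A`, ties being broken uniformly at random. -/
noncomputable def alloc (G : AuditGame X Z) (A : Fin n → X × Z) (i : Fin n) : ℝ :=
  max 0 (min 1 (((G.k : ℝ) - ({j | G.f (A i) < G.f (A j)} : Set (Fin n)).ncard) /
    ({j | G.f (A j) = G.f (A i)} : Set (Fin n)).ncard))

/-- The expectation of `F` over the profile in which agent `i` reports `a` and all other agents report
their types, which are independent with distribution `D`. (The product runs over all agents; the type
drawn for agent `i` is overwritten by `a`.) -/
noncomputable def expect [Fintype X] [Fintype Z] (G : AuditGame X Z) (i : Fin n) (a : X × Z)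
    (F : (Fin n → X × Z) → ℝ) : ℝ :=
  open Classical in
  ∑ A : Fin n → X × Z, (∏ j, (G.D (A j)).toReal) * F (Function.update A i a)

/-- The probability that agent `i` is allocated a resource, barring audits, on reporting `a`. -/
noncomputable def chance [Fintype X] [Fintype Z] (G : AuditGame X Z) (i : Fin n) (a : X × Z) : ℝ :=
  G.expect i a (fun A => G.alloc A i)

/-- An audit policy: for each profile of reports, the probability of auditing each agent, the expected
number of audits being at most the budget. -/
structure IsAuditPolicy (G : AuditGame X Z) (φ : (Fin n → X × Z) → Fin n → ℝ) : Prop where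
  nonneg : ∀ A i, 0 ≤ φ A i
  le_one : ∀ A i, φ A i ≤ 1
  budget : ∀ A, ∑ i, φ A i ≤ G.B

/-- The expected utility under the policy `φ` of agent `i` with true type `a` who reports `b`, all
other agents being truthful. A liar who is audited loses the resource and pays the fine. -/
noncomputable def utility [Fintype X] [Fintype Z] (G : AuditGame X Z)
    (φ : (Fin n → X × Z) → Fin n → ℝ) (i : Fin n) (a b : X × Z) : ℝ :=
  open Classical in
  if b = a then G.expect i b (fun A => G.alloc A i)
  else G.expect i b (fun A => G.alloc A i * (1 - φ A i) - G.c * φ A i)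

/-- `φ` is `ε`-Bayes–Nash incentive compatible: no agent gains more than `ε` by misreporting the
self-reported part of the type. -/
def IsBNIC [Fintype X] [Fintype Z] (G : AuditGame X Z) (φ : (Fin n → X × Z) → Fin n → ℝ)
    (ε : ℝ) : Prop :=
  ∀ (i : Fin n) (a b : X × Z), G.D a ≠ 0 → b.1 = a.1 →
    G.utility φ i a a ≥ G.utility φ i a b - ε

/-- `φ` is an optimal audit policy: it is `ε`-BNIC with the smallest possible `ε`. -/
def IsOptimal [Fintype X] [Fintype Z] (G : AuditGame X Z)
    (φ : (Fin n → X × Z) → Fin n → ℝ) : Prop :=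
  G.IsAuditPolicy φ ∧ ∃ ε, G.IsBNIC φ ε ∧
    ∀ (ψ : (Fin n → X × Z) → Fin n → ℝ) (δ : ℝ), G.IsAuditPolicy ψ → G.IsBNIC ψ δ → ε ≤ δ

/-- `a` is a minimum type: among the types of positive probability with the same known part, it has
the lowest score. -/
def IsMinimumType (G : AuditGame X Z) (a : X × Z) : Prop :=
  G.D a ≠ 0 ∧ ∀ z, G.D (a.1, z) ≠ 0 → G.f a ≤ G.f (a.1, z)

/-- The report `b` of agent `i` is suspicious: the minimum type with the same known part has a
strictly lower chance of being allocated a resource. -/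
def IsSuspicious [Fintype X] [Fintype Z] (G : AuditGame X Z) (i : Fin n) (b : X × Z) : Prop :=
  ∃ z, G.IsMinimumType (b.1, z) ∧ G.chance i (b.1, z) < G.chance i b

/-- The report `b` of agent `i` is a sure-truth: it is neither a sure-lie nor suspicious. -/
def IsSureTruth [Fintype X] [Fintype Z] (G : AuditGame X Z) (i : Fin n) (b : X × Z) : Prop :=
  G.D b ≠ 0 ∧ ¬ G.IsSuspicious i b

end AuditGame

/-! ### The computational problem -/

/-- An instance with `n` agents, `d` known and `s` self-reported binary features. The score function
is given by a program together with a bound on its running time. -/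
structure AuditInstance (n : ℕ) where
  d : ℕ
  s : ℕ
  prog : StackProg
  clock : ℕ
  k : ℕ
  budget : ℚ≥0
  fine : ℚ≥0
  /-- The reports that the principal has received. -/
  reports : Fin n → (Fin d → Bool) × (Fin s → Bool)

namespace AuditInstance

variable {n : ℕ}

/-- The score of `(x, z)`: the natural number, least significant bit first, on stack `0` when the
program has been run on `x`, `z` for `clock` steps (or has halted earlier). -/
def score (J : AuditInstance n) (a : (Fin J.d → Bool) × (Fin J.s → Bool)) : ℕ :=
  Nat.ofDigits 2 (((StackProg.step^[J.clock]
    (J.prog.start [List.ofFn a.1, List.ofFn a.2])).2 0).map Bool.toNat)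

/-- The audit game of the instance; types are uniformly distributed. -/
noncomputable def game (J : AuditInstance n) : AuditGame (Fin J.d → Bool) (Fin J.s → Bool) where
  D := PMF.uniformOfFintype _
  f := fun a => J.score a
  k := J.k
  B := (J.budget : ℝ)
  c := (J.fine : ℝ)

/-- The program `T` identifies the sure-truths of the instance, in at most `C` steps each. -/
def SureTruthsIdentifiedBy (J : AuditInstance n) (T : StackProg) (C : ℕ) : Prop :=
  ∀ (i : Fin n) (a : (Fin J.d → Bool) × (Fin J.s → Bool)), ∃ b : Bool,
    T.Answers [List.ofFn a.1, List.ofFn a.2] C b ∧ (b = true ↔ J.game.IsSureTruth i a)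

/-- `y` is the indicator vector of the set of agents that some optimal audit policy audits with
positive probability on the reports received. -/
def IsAuditedSet (J : AuditInstance n) (y : List Bool) : Prop :=
  ∃ φ : (Fin n → (Fin J.d → Bool) × (Fin J.s → Bool)) → Fin n → ℝ, J.game.IsOptimal φ ∧
    ∃ v : Fin n → Bool, y = List.ofFn v ∧ ∀ i, v i = true ↔ 0 < φ J.reports i

end AuditInstance

/-! ### Encoding of instances as strings (self-delimiting codes, concatenated) -/

/-- Unary code of a number. -/
def codeUnary (m : ℕ) : List Bool := List.replicate m true ++ [false]

/-- Self-delimiting code of a string. -/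
def codeBits : List Bool → List Bool
  | [] => [false]
  | b :: l => true :: b :: codeBits l

/-- Binary code of a number, made self-delimiting. -/
def codeBinary (m : ℕ) : List Bool := codeBits (Computability.encodeNat m)

/-- Prefix code of a program. -/
def codeProg : StackProg → List Bool
  | .skip => codeUnary 0
  | .push r b => codeUnary 1 ++ codeUnary r ++ [b]
  | .pop r => codeUnary 2 ++ codeUnary r
  | .seq p q => codeUnary 3 ++ codeProg p ++ codeProg q
  | .test r p q e => codeUnary 4 ++ codeUnary r ++ codeProg p ++ codeProg q ++ codeProg e
  | .loop r p => codeUnary 5 ++ codeUnary r ++ codeProg p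

/-- Code of a profile of reports. -/
def codeReports {d s : ℕ} : {n : ℕ} → (Fin n → (Fin d → Bool) × (Fin s → Bool)) → List Bool
  | 0, _ => []
  | _ + 1, A => codeBits (List.ofFn (A 0).1) ++ codeBits (List.ofFn (A 0).2) ++
      codeReports (fun i => A i.succ)

/-- Code of an instance: dimensions, running-time bound and `k` in unary, rationals in binary. -/
def AuditInstance.code {n : ℕ} (J : AuditInstance n) : List Bool :=
  codeUnary J.d ++ codeUnary J.s ++ codeProg J.prog ++ codeUnary J.clock ++ codeUnary J.k ++
    codeBinary J.budget.num ++ codeBinary J.budget.den ++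
    codeBinary J.fine.num ++ codeBinary J.fine.den ++ codeReports J.reports

theorem codeUnary_append_inj {m m' : ℕ} {u u' : List Bool}
    (h : codeUnary m ++ u = codeUnary m' ++ u') : m = m' ∧ u = u' := by
  induction m generalizing m' with
  | zero => cases m' <;> simp_all [codeUnary, List.replicate_succ]
  | succ m ih =>
    cases m' with
    | zero => simp_all [codeUnary, List.replicate_succ]
    | succ m' =>
      have := @ih m' (by simpa [codeUnary, List.replicate_succ] using h)
      simpa using this

theorem codeBits_append_inj {l l' u u' : List Bool}
    (h : codeBits l ++ u = codeBits l' ++ u') : l = l' ∧ u = u' := by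
  induction l generalizing l' with
  | nil => cases l' <;> simp_all [codeBits]
  | cons b l ih =>
    cases l' with
    | nil => simp_all [codeBits]
    | cons b' l' =>
      simp only [codeBits, List.cons_append, List.cons.injEq, true_and] at h
      obtain ⟨rfl, h⟩ := h
      simpa using ih h

theorem codeBinary_append_inj {m m' : ℕ} {u u' : List Bool}
    (h : codeBinary m ++ u = codeBinary m' ++ u') : m = m' ∧ u = u' := by
  obtain ⟨h₁, h₂⟩ := codeBits_append_inj h
  refine ⟨?_, h₂⟩
  rw [← Computability.decode_encodeNat m, ← Computability.decode_encodeNat m', h₁]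

theorem codeProg_append_inj {p p' : StackProg} {u u' : List Bool}
    (h : codeProg p ++ u = codeProg p' ++ u') : p = p' ∧ u = u' := by
  induction p generalizing p' u u' with
  | skip =>
    cases p' <;> simp only [codeProg, List.append_assoc] at h <;>
      obtain ⟨h₀, h⟩ := codeUnary_append_inj h <;> first | omega | exact ⟨rfl, h⟩
  | push r b =>
    cases p' <;> simp only [codeProg, List.append_assoc] at h <;>
      obtain ⟨h₀, h⟩ := codeUnary_append_inj h <;> first | omega | skip
    obtain ⟨rfl, g1⟩ := codeUnary_append_inj h
    simpa using g1
  | pop r =>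
    cases p' <;> simp only [codeProg, List.append_assoc] at h <;>
      obtain ⟨h₀, h⟩ := codeUnary_append_inj h <;> first | omega | skip
    obtain ⟨rfl, g1⟩ := codeUnary_append_inj h
    simpa using g1
  | seq p q ihp ihq =>
    cases p' <;> simp only [codeProg, List.append_assoc] at h <;>
      obtain ⟨h₀, h⟩ := codeUnary_append_inj h <;> first | omega | skip
    obtain ⟨rfl, g1⟩ := ihp h
    obtain ⟨rfl, g2⟩ := ihq g1
    exact ⟨rfl, g2⟩
  | test r p q e ihp ihq ihe =>
    cases p' <;> simp only [codeProg, List.append_assoc] at h <;>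
      obtain ⟨h₀, h⟩ := codeUnary_append_inj h <;> first | omega | skip
    obtain ⟨rfl, g1⟩ := codeUnary_append_inj h
    obtain ⟨rfl, g2⟩ := ihp g1
    obtain ⟨rfl, g3⟩ := ihq g2
    obtain ⟨rfl, g4⟩ := ihe g3
    exact ⟨rfl, g4⟩
  | loop r p ih =>
    cases p' <;> simp only [codeProg, List.append_assoc] at h <;>
      obtain ⟨h₀, h⟩ := codeUnary_append_inj h <;> first | omega | skip
    obtain ⟨rfl, g1⟩ := codeUnary_append_inj h
    obtain ⟨rfl, g2⟩ := ih g1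
    exact ⟨rfl, g2⟩

theorem codeReports_injective {d s n : ℕ} :
    Function.Injective (codeReports (d := d) (s := s) (n := n)) := by
  induction n with
  | zero => intro A A' _; exact Subsingleton.elim _ _
  | succ n ih =>
    intro A A' h
    simp only [codeReports, List.append_assoc] at h
    obtain ⟨h₁, g1⟩ := codeBits_append_inj h
    obtain ⟨h₂, g2⟩ := codeBits_append_inj g1
    have h₃ := ih g2
    funext i
    refine Fin.cases ?_ (fun j => congrFun h₃ j) i
    exact Prod.ext (List.ofFn_injective h₁) (List.ofFn_injective h₂)

theorem AuditInstance.code_injective {n : ℕ} :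
    Function.Injective (AuditInstance.code (n := n)) := by
  rintro ⟨d, s, p, t, k, B, c, A⟩ ⟨d', s', p', t', k', B', c', A'⟩ h
  simp only [AuditInstance.code, List.append_assoc] at h
  obtain ⟨rfl, g1⟩ := codeUnary_append_inj h
  obtain ⟨rfl, g2⟩ := codeUnary_append_inj g1
  obtain ⟨rfl, g3⟩ := codeProg_append_inj g2
  obtain ⟨rfl, g4⟩ := codeUnary_append_inj g3
  obtain ⟨rfl, g5⟩ := codeUnary_append_inj g4
  obtain ⟨h₁, g6⟩ := codeBinary_append_inj g5
  obtain ⟨h₂, g7⟩ := codeBinary_append_inj g6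
  obtain ⟨h₃, g8⟩ := codeBinary_append_inj g7
  obtain ⟨h₄, g9⟩ := codeBinary_append_inj g8
  obtain rfl := NNRat.ext_num_den h₁ h₂
  obtain rfl := NNRat.ext_num_den h₃ h₄
  obtain rfl := codeReports_injective g9
  rfl

/-- The problem of determining which agents should be audited, for `n` agents and uniformly
distributed binary features, restricted to the instances with `1 ≤ k ≤ n` and a monotone score
function on which the program `T` identifies the sure-truths in at most `C` steps. -/
def topKAuditProblem (n : ℕ) (T : StackProg) (C : ℕ) : SearchProblem (AuditInstance n) where
  encode := AuditInstance.code
  encode_injective := AuditInstance.code_injective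
  Admissible := fun J =>
    1 ≤ J.k ∧ J.k ≤ n ∧ Monotone J.score ∧ J.SureTruthsIdentifiedBy T C
  IsSolution := AuditInstance.IsAuditedSet

/-! Fix a language in NP, a verifier `V` and an input `w`. The score function is a program with `w`
built in that reads a candidate certificate off the known features and runs `V` on it. Write `K = 2
^ m`; there are `N = 16 K` types.

With four agents and three resources, an agent goes without only if nobody scores lower. If `v`
types score at least, and `u` types more than, the reported score, the chance of a resource is `1 -
(v³ + v²u + vu² + u³) / (4N³)` (`chance_eq_cubicMean`). Moving up past a single type is therefore
worth more the lower it happens: near a rank `x`, counted from the top, it is worth about `12x²` in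
units of `1 / (4N³)`.

The profitable lies are those from score 7 to 8, one lie from 1 to 4 and one from 2 to 6
(`reportScore_cases`). Scores 1, 2, 4 and 6 are each attained by a single type, and valid
certificates score 5. Without a valid certificate, the moves 1 → 4 and 2 → 6 differ by one step at
the bottom (rank about `12K`) against one step at the top (rank at most `10K`), so 1 → 4 gains more.
One valid certificate gives at least two types of score 5, hence 2 → 6 has at least three steps at
the top, each at rank about `8K` or more; since `3·8² > 12²`, 2 → 6 now gains more (`gains`).

In both cases the best lie beats every other one by `B(1 + c)`, the most that audits can take from a
lie. The whole budget is then best spent on reports of that lie. Averaging the audit losses over the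
agents shows that sharing the budget among those who make this report is optimal, and equality in
the average forces every optimal policy to audit with probability `B` an agent who alone makes it,
and nobody else (`IsDominantLie.eq_budget_of_isOptimal`). In the profile of the instance agent 0
reports the type of score 4 and agent 1 that of score 6, so whether agent 0 is audited reveals
whether a certificate exists.

Two features of the score serve the restrictions. Certificates are written with pairs 10 and 01, so
that raising a bit of a valid one yields a pair 11, which scores 7, and lowering a bit a pair 00,
which scores at most 3 unless a pair 11 occurs: this makes the score monotone. The pairs of scores 7
and 8 make every report with known part 01… and self-report 1 suspicious, so that a sure-truth is
recognised from three bits. -/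

namespace StackProg

open Function

/-! ### Execution rules for stack programs. -/

theorem update_of_eq {σ : Store} {r : ℕ} {l : List Bool} (h : σ r = l) : update σ r l = σ := by
  rw [← h, update_eq_self]

variable {p q e : StackProg} {σ σ' σ'' : Store} {r T T' T₁ T₂ : ℕ} {b : Bool} {l : List Bool}

/-- Within `T` steps, `p` turns the store `σ` into `σ'`, whatever programs are to be run after it. -/
def Runs (p : StackProg) (σ σ' : Store) (T : ℕ) : Prop :=
  ∃ t ≤ T, ∀ κ, step^[t] (p :: κ, σ) = (κ, σ')

theorem Runs.mono (h : Runs p σ σ' T) (hT : T ≤ T') : Runs p σ σ' T' :=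
  let ⟨t, ht, h⟩ := h; ⟨t, ht.trans hT, h⟩

theorem Runs.of_eq (h : Runs p σ σ' T) (hσ : σ' = σ'') (hT : T ≤ T') : Runs p σ σ'' T' :=
  hσ ▸ h.mono hT

theorem runs_skip : Runs skip σ σ 1 := ⟨1, le_rfl, fun _ => rfl⟩

theorem runs_push : Runs (push r b) σ (update σ r (b :: σ r)) 1 := ⟨1, le_rfl, fun _ => rfl⟩

theorem runs_pop : Runs (pop r) σ (update σ r (σ r).tail) 1 := ⟨1, le_rfl, fun _ => rfl⟩

theorem Runs.seq (h₁ : Runs p σ σ' T₁) (h₂ : Runs q σ' σ'' T₂) :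
    Runs (seq p q) σ σ'' (T₁ + T₂ + 1) := by
  obtain ⟨t₁, ht₁, h₁⟩ := h₁
  obtain ⟨t₂, ht₂, h₂⟩ := h₂
  refine ⟨t₂ + t₁ + 1, by omega, fun κ => ?_⟩
  rw [iterate_succ_apply, iterate_add_apply]
  simp only [step, h₁, h₂]

theorem Runs.test_true (hr : σ r = true :: l) (h : Runs p σ σ' T) :
    Runs (test r p q e) σ σ' (T + 1) := by
  obtain ⟨t, ht, h⟩ := h
  refine ⟨t + 1, by omega, fun κ => ?_⟩
  rw [iterate_succ_apply]
  simp only [step, hr, h]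

theorem Runs.test_false (hr : σ r = false :: l) (h : Runs q σ σ' T) :
    Runs (test r p q e) σ σ' (T + 1) := by
  obtain ⟨t, ht, h⟩ := h
  refine ⟨t + 1, by omega, fun κ => ?_⟩
  rw [iterate_succ_apply]
  simp only [step, hr, h]

theorem Runs.test_nil (hr : σ r = []) (h : Runs e σ σ' T) :
    Runs (test r p q e) σ σ' (T + 1) := by
  obtain ⟨t, ht, h⟩ := h
  refine ⟨t + 1, by omega, fun κ => ?_⟩
  rw [iterate_succ_apply]
  simp only [step, hr, h]

theorem runs_loop_nil (hr : σ r = []) : Runs (loop r p) σ σ 1 := by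
  refine ⟨1, le_rfl, fun κ => ?_⟩
  simp only [iterate_one, step, hr]

theorem Runs.loop_cons (hr : σ r = b :: l) (h₁ : Runs p σ σ' T₁)
    (h₂ : Runs (loop r p) σ' σ'' T₂) : Runs (loop r p) σ σ'' (T₁ + T₂ + 1) := by
  obtain ⟨t₁, ht₁, h₁⟩ := h₁
  obtain ⟨t₂, ht₂, h₂⟩ := h₂
  refine ⟨t₂ + t₁ + 1, by omega, fun κ => ?_⟩
  rw [iterate_succ_apply, iterate_add_apply]
  simp only [step, hr, h₁, h₂]

/-- A step looks only at the first pending program. An empty `κ₀` is excluded because it is halted,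
while `κ` would go on running. -/
theorem step_append (κ₀ κ : List StackProg) (σ : Store) (h : κ₀ ≠ []) :
    step (κ₀ ++ κ, σ) = ((step (κ₀, σ)).1 ++ κ, (step (κ₀, σ)).2) := by
  match κ₀ with
  | skip :: _ => rfl
  | push _ _ :: _ => rfl
  | pop _ :: _ => rfl
  | seq _ _ :: _ => rfl
  | test r _ _ _ :: _ => simp only [List.cons_append, step]; split <;> rfl
  | loop r _ :: _ => simp only [List.cons_append, step]; split <;> rfl

/-- A run that has halted idles until time `t`, whereas with `κ` waiting those idle steps would
already execute `κ`. Hence a shorter time `t'`, the moment of halting. -/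
theorem iterate_step_append (t : ℕ) (κ₀ : List StackProg) (σ : Store)
    (h : (step^[t] (κ₀, σ)).1 = []) :
    ∃ t' ≤ t, ∀ κ, step^[t'] (κ₀ ++ κ, σ) = (κ, (step^[t] (κ₀, σ)).2) := by
  induction t generalizing κ₀ σ with
  | zero => exact ⟨0, le_rfl, fun κ => by simp at h; simp [h]⟩
  | succ t ih =>
    rcases eq_or_ne κ₀ [] with rfl | hκ
    · refine ⟨0, by omega, fun κ => ?_⟩
      have : step^[t + 1] ([], σ) = ([], σ) := iterate_fixed rfl _
      simp [this]
    · rw [iterate_succ_apply] at h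
      obtain ⟨t', ht', h'⟩ := ih (step (κ₀, σ)).1 (step (κ₀, σ)).2 h
      refine ⟨t' + 1, by omega, fun κ => ?_⟩
      rw [iterate_succ_apply, iterate_succ_apply, step_append _ _ _ hκ]
      exact h' κ

theorem runs_of_halts {t : ℕ} (h : (step^[t] ([p], σ)).1 = []) :
    Runs p σ (step^[t] ([p], σ)).2 t :=
  iterate_step_append t [p] σ h

theorem Answers.runs {inputs : List (List Bool)} (h : p.Answers inputs T b) :
    ∃ σ', Runs p (fun j => inputs.getD j []) σ' T ∧ (σ' 0).head? = some b := by
  obtain ⟨t, ht, h, h'⟩ := h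
  exact ⟨_, (runs_of_halts h).mono ht, h'⟩

theorem Runs.iterate_start {inputs : List (List Bool)}
    (h : Runs p (fun j => inputs.getD j []) σ' T) (hT : T ≤ T') :
    step^[T'] (p.start inputs) = ([], σ') := by
  obtain ⟨t, ht, h⟩ := h
  obtain ⟨u, rfl⟩ := Nat.exists_eq_add_of_le (ht.trans hT)
  rw [add_comm, iterate_add_apply, start, h []]
  exact iterate_fixed rfl _

theorem Runs.haltsWith {inputs : List (List Bool)}
    (h : Runs p (fun j => inputs.getD j []) σ' T) : p.HaltsWith inputs T (σ' 0) :=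
  ⟨T, le_rfl, by simp [h.iterate_start le_rfl]⟩

theorem length_step_le (c : Config) (r : ℕ) : ((step c).2 r).length ≤ (c.2 r).length + 1 := by
  obtain ⟨κ, σ⟩ := c
  match κ with
  | [] => simp [step]
  | skip :: _ => simp [step]
  | push r' b :: _ =>
    rcases eq_or_ne r r' with rfl | h
    · simp [step]
    · simp [step, update_of_ne h]
  | pop r' :: _ =>
    rcases eq_or_ne r r' with rfl | h
    · simp [step]; omega
    · simp [step, update_of_ne h]
  | seq _ _ :: _ => simp [step]
  | test r' _ _ _ :: _ => simp only [step]; split <;> simp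
  | loop r' _ :: _ => simp only [step]; split <;> simp

/-- Each step pushes at most one bit. This bounds the cost of clearing or moving what an arbitrary
program has left on a stack. -/
theorem Runs.length_le (h : Runs p σ σ' T) (r : ℕ) : (σ' r).length ≤ (σ r).length + T := by
  obtain ⟨t, ht, h⟩ := h
  have key : ∀ (t : ℕ) (c : Config), ((step^[t] c).2 r).length ≤ (c.2 r).length + t := by
    intro t
    induction t with
    | zero => simp
    | succ t ih =>
      intro c
      rw [iterate_succ_apply]
      have := ih (step c)
      have := length_step_le c r
      omega
  have := key t ([p], σ)
  rw [h []] at this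
  simp only at this
  omega

/-! ### Basic programs -/

/-- Empty stack `r`. -/
def clear (r : ℕ) : StackProg := loop r (pop r)

theorem runs_clear : Runs (clear r) σ (update σ r []) (2 * (σ r).length + 1) := by
  induction h : σ r generalizing σ with
  | nil => exact (runs_loop_nil h).of_eq (by rw [← h, update_eq_self]) (by simp)
  | cons b l ih =>
    have h' : update σ r (σ r).tail r = l := by simp [h]
    exact (Runs.loop_cons h runs_pop (ih h')).of_eq (by simp) (by simp; omega)

/-- Put the string `l` on top of stack `r`. -/
def pushes (r : ℕ) : List Bool → StackProg
  | [] => skip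
  | b :: l => seq (pushes r l) (push r b)

theorem runs_pushes : Runs (pushes r l) σ (update σ r (l ++ σ r)) (2 * l.length + 1) := by
  induction l with
  | nil => exact runs_skip.of_eq (by simp) (by simp)
  | cons b l ih => exact (ih.seq runs_push).of_eq (by simp) (by simp; omega)

/-- Move stack `r` bit by bit to stack `s`. -/
def move (r s : ℕ) : StackProg :=
  loop r (test r (seq (pop r) (push s true)) (seq (pop r) (push s false)) skip)

theorem runs_move {s : ℕ} (hrs : r ≠ s) :
    Runs (move r s) σ (update (update σ r []) s ((σ r).reverse ++ σ s))
      (5 * (σ r).length + 1) := by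
  induction h : σ r generalizing σ with
  | nil => exact (runs_loop_nil h).of_eq (by simp [update_of_eq h]) (by simp)
  | cons b l ih =>
    have h₁ : Runs (test r (seq (pop r) (push s true)) (seq (pop r) (push s false)) skip) σ
        (update (update σ r l) s (b :: σ s)) 4 := by
      cases b
      · exact (Runs.test_false h (runs_pop.seq runs_push)).of_eq
          (by simp [h, update_of_ne hrs.symm]) (by simp)
      · exact (Runs.test_true h (runs_pop.seq runs_push)).of_eq
          (by simp [h, update_of_ne hrs.symm]) (by simp)
    have h' : update (update σ r l) s (b :: σ s) r = l := by simp [update_of_ne hrs]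
    refine (Runs.loop_cons h h₁ (ih h')).of_eq ?_ (by simp; omega)
    rw [update_comm hrs.symm]
    simp

end StackProg

/-! ### Copying the input. -/

namespace StackProg

open Function

variable {σ σ' : Store} {j : ℕ}

/-- Move stack `0` to stack `j` and put a copy of it on stack `j + 1`. -/
def split (j : ℕ) : StackProg :=
  loop 0 (test 0 (seq (pop 0) (seq (push j true) (push (j + 1) true)))
    (seq (pop 0) (seq (push j false) (push (j + 1) false))) skip)

theorem runs_split (hj : 2 ≤ j) :
    Runs (split j) σ (update (update (update σ 0 []) j ((σ 0).reverse ++ σ j)) (j + 1)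
      ((σ 0).reverse ++ σ (j + 1))) (7 * (σ 0).length + 1) := by
  have h0 : (0 : ℕ) ≠ j := by omega
  have h1 : (0 : ℕ) ≠ j + 1 := by omega
  have h2 : j ≠ j + 1 := by omega
  induction h : σ 0 generalizing σ with
  | nil => exact (runs_loop_nil h).of_eq (by simp [update_of_eq h]) (by simp)
  | cons b l ih =>
    have hb : Runs (test 0 (seq (pop 0) (seq (push j true) (push (j + 1) true)))
        (seq (pop 0) (seq (push j false) (push (j + 1) false))) skip) σ
        (update (update (update σ 0 l) j (b :: σ j)) (j + 1) (b :: σ (j + 1))) 6 := by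
      cases b
      · exact (Runs.test_false h (runs_pop.seq (runs_push.seq runs_push))).of_eq
          (by simp [h, update_of_ne, h0.symm]) (by simp)
      · exact (Runs.test_true h (runs_pop.seq (runs_push.seq runs_push))).of_eq
          (by simp [h, update_of_ne, h0.symm]) (by simp)
    refine (Runs.loop_cons h hb (ih (by simp [update_of_ne, h0]))).of_eq ?_ (by simp; omega)
    funext r
    by_cases r0 : r = 0
    · subst r0; simp [update_of_ne, h0]
    by_cases r1 : r = j
    · subst r1; simp [update_of_ne]
    by_cases r2 : r = j + 1
    · subst r2; simp
    simp [update_of_ne, r0, r1, r2]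

/-- Put the reverse of stack `0` on stack `j`, using stack `j + 1`. -/
def copy (j : ℕ) : StackProg := seq (split j) (move (j + 1) 0)

theorem runs_copy (hj : 2 ≤ j) (h₁ : σ j = []) (h₂ : σ (j + 1) = []) :
    Runs (copy j) σ (update σ j (σ 0).reverse) (12 * (σ 0).length + 3) := by
  have h1 : j + 1 ≠ 0 := by omega
  refine ((runs_split hj).seq (runs_move h1)).of_eq ?_ (by simp [h₂]; omega)
  have h0 : (0 : ℕ) ≠ j := by omega
  have h2 : j ≠ j + 1 := by omega
  funext r
  by_cases r0 : r = 0
  · subst r0; simp [update_of_ne, h0, h₂]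
  by_cases r1 : r = j
  · subst r1; simp [update_of_ne, h0.symm, h₁]
  by_cases r2 : r = j + 1
  · subst r2; simp [update_of_ne, h₂]
  simp [update_of_ne, r0, r1, r2]

end StackProg

/-! ### Strings emitted in polynomial time. -/

open StackProg Function

/-- `F` can be emitted in polynomial time: using only scratch stacks from `j` on, a program puts
`F w` on top of stack `1`, where `w` is the string on stack `0`. -/
def Emittable (F : List Bool → List Bool) : Prop :=
  ∀ j, 2 ≤ j → ∃ (p : StackProg) (q : Polynomial ℕ), ∀ σ : Store, (∀ r, j ≤ r → σ r = []) →
    Runs p σ (update σ 1 (F (σ 0) ++ σ 1)) (q.eval (σ 0).length)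

theorem emittable_const (l : List Bool) : Emittable (fun _ => l) := fun _ _ =>
  ⟨pushes 1 l, Polynomial.C (2 * l.length + 1), fun _ _ => runs_pushes.mono (by simp)⟩

/-- The front of a string is the top of the stack, so the second factor is emitted first. -/
theorem Emittable.append {F G : List Bool → List Bool} (hF : Emittable F) (hG : Emittable G) :
    Emittable (fun w => F w ++ G w) := by
  intro j hj
  obtain ⟨p, a, hp⟩ := hF j hj
  obtain ⟨q, b, hq⟩ := hG j hj
  refine ⟨seq q p, b + a + 1, fun σ hσ => ?_⟩
  refine ((hq σ hσ).seq (hp _ fun r hr => ?_)).of_eq ?_ ?_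
  · rw [update_of_ne (by omega), hσ r hr]
  · simp
  · simp

/-- A reversed copy of the input on stack `j` drives the loop: it delivers the last bit first, the
order in which pieces have to be stacked. Stack 0 stays intact, so each piece may depend on the
whole input; the pieces use scratch stacks from `j + 1` on. -/
theorem Emittable.flatMap {F : Bool → List Bool → List Bool} (hF : ∀ b, Emittable (F b)) :
    Emittable (fun w => w.flatMap fun b => F b w) := by
  intro j hj
  obtain ⟨p, a, hp⟩ := hF true (j + 1) (by omega)
  obtain ⟨q, b, hq⟩ := hF false (j + 1) (by omega)
  let body := test j (seq (pop j) p) (seq (pop j) q) skip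
  have hbody : ∀ (l : List Bool) (σ : Store), (∀ r, j + 1 ≤ r → σ r = []) → σ j = l →
      Runs (loop j body) σ
        (update (update σ j []) 1 ((l.reverse.flatMap fun b => F b (σ 0)) ++ σ 1))
        (l.length * ((a + b).eval (σ 0).length + 4) + 1) := by
    intro l
    induction l with
    | nil => exact fun σ _ h => (runs_loop_nil h).of_eq (by simp [update_of_eq h]) (by simp)
    | cons c l ih =>
      intro σ hσ h
      have h0 : (0 : ℕ) ≠ j := by omega
      have h1 : (1 : ℕ) ≠ j := by omega
      have hσ' : ∀ r, j + 1 ≤ r → update σ j l r = [] := fun r hr => by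
        rw [update_of_ne (by omega), hσ r hr]
      have hc : Runs body σ (update (update σ j l) 1 (F c (σ 0) ++ σ 1))
          ((a + b).eval (σ 0).length + 3) := by
        have hpop : Runs (pop j) σ (update σ j l) 1 := runs_pop.of_eq (by simp [h]) le_rfl
        cases c
        · exact (Runs.test_false h (hpop.seq (hq _ hσ'))).of_eq
            (by simp [update_of_ne, h0, h1]) (by simp [update_of_ne, h0]; omega)
        · exact (Runs.test_true h (hpop.seq (hp _ hσ'))).of_eq
            (by simp [update_of_ne, h0, h1]) (by simp [update_of_ne, h0]; omega)
      refine (Runs.loop_cons h hc (ih _ (fun r hr => ?_) ?_)).of_eq ?_ ?_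
      · rw [update_of_ne (by omega), hσ' r hr]
      · simp [update_of_ne, h1.symm]
      · rw [update_comm h1]
        simp [update_of_ne, h0]
      · simp [update_of_ne, h0]
        ring_nf
        omega
  refine ⟨seq (copy j) (loop j body),
    12 * Polynomial.X + 5 + Polynomial.X * (a + b + 4), fun σ hσ => ?_⟩
  have h0 : (0 : ℕ) ≠ j := by omega
  have h1 : (1 : ℕ) ≠ j := by omega
  refine ((runs_copy hj (hσ _ le_rfl) (hσ _ (by omega))).seq
    (hbody _ _ (fun r hr => ?_) (update_self ..))).of_eq ?_ ?_
  · rw [update_of_ne (by omega), hσ r (by omega)]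
  · simp [update_of_ne, h0, h1, ← hσ j le_rfl]
  · simp [update_of_ne, h0]
    ring_nf
    omega

/-- The string `l`, `n` times. -/
def rep (n : ℕ) (l : List Bool) : List Bool := (List.replicate n l).flatten

theorem rep_add (m n : ℕ) (l : List Bool) : rep (m + n) l = rep m l ++ rep n l := by
  rw [rep, List.replicate_add, List.flatten_append, rep, rep]

theorem rep_mul_length (m : ℕ) (l w : List Bool) :
    rep (m * w.length) l = w.flatMap fun _ => rep m l := by
  induction w with
  | nil => simp [rep]
  | cons b w ih => rw [List.flatMap_cons, ← ih, ← rep_add]; congr 1; simp; ring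

theorem rep_singleton (n : ℕ) (b : Bool) : rep n [b] = List.replicate n b := by
  induction n with
  | zero => rfl
  | succ n ih => simp [rep, List.replicate_succ]

/-- Multiplying the number of repetitions by the input length is a `flatMap` over the input, and
adding is concatenation; induction on the polynomial does the rest. -/
theorem emittable_rep (P : Polynomial ℕ) (l : List Bool) :
    Emittable (fun w => rep (P.eval w.length) l) := by
  induction P using Polynomial.induction_on with
  | C a => simpa using emittable_const (rep a l)
  | add p q hp hq => simpa [rep_add] using hp.append hq
  | monomial n a h =>
    have := Emittable.flatMap (F := fun _ => _) (fun _ => h)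
    simp only [← rep_mul_length] at this
    simpa [pow_succ, mul_assoc] using this

theorem emittable_codeUnary (P : Polynomial ℕ) :
    Emittable (fun w => codeUnary (P.eval w.length)) := by
  simpa [codeUnary, rep_singleton] using (emittable_rep P [true]).append (emittable_const [false])

/-- Emittable functions are computable in polynomial time. -/
theorem Emittable.polyTimeComputable {F : List Bool → List Bool} (hF : Emittable F) :
    PolyTimeComputable F := by
  obtain ⟨p, q, h⟩ := hF 2 le_rfl
  -- Moving a stack reverses it, so the output goes from stack 1 to stack 0 by way of stack 2.
  refine ⟨seq p (seq (clear 0) (seq (move 1 2) (move 2 0))),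
    q + (2 * Polynomial.X + 1) + 10 * q + 10, fun w => ?_⟩
  have h₁ : Runs p (fun j => [w].getD j []) _ _ := h _ fun r hr => by
    obtain ⟨r, rfl⟩ := Nat.exists_eq_add_of_le' hr
    simp
  have hlen := h₁.length_le 1
  have h₂ := h₁.seq ((runs_clear (r := 0)).seq ((runs_move (r := 1) (s := 2) (by norm_num)).seq
    (runs_move (r := 2) (s := 0) (by norm_num))))
  have h₃ := h₂.haltsWith
  simp [update_of_ne] at h₃ hlen
  obtain ⟨t, ht, h₄⟩ := h₃
  refine ⟨t, ht.trans ?_, h₄⟩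
  simp
  omega

/-! ### Optimal policies when one lie dominates. -/

namespace AuditGame

open Function Finset

section Expectation

variable {X Z : Type} [Fintype X] [Fintype Z] {n : ℕ} {G : AuditGame X Z}

theorem expect_of_uniform [Nonempty (X × Z)] (hD : G.D = PMF.uniformOfFintype _) (i : Fin n)
    (a : X × Z) (F : (Fin n → X × Z) → ℝ) :
    G.expect i a F = ((Fintype.card (X × Z) : ℝ)⁻¹) ^ n * ∑ A, F (update A i a) := by
  unfold expect
  rw [Finset.mul_sum]
  refine Finset.sum_congr rfl fun A _ => ?_
  congr 1
  simp [hD]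

theorem expect_sub (i : Fin n) (a : X × Z) (F H : (Fin n → X × Z) → ℝ) :
    G.expect i a (fun A => F A - H A) = G.expect i a F - G.expect i a H := by
  simp only [expect, mul_sub, Finset.sum_sub_distrib]

theorem expect_le_of_le [Nonempty (X × Z)] (hD : G.D = PMF.uniformOfFintype _) (i : Fin n)
    (a : X × Z) (F : (Fin n → X × Z) → ℝ) {M : ℝ} (h : ∀ A, F A ≤ M) : G.expect i a F ≤ M := by
  rw [expect_of_uniform hD]
  have h1 : ∑ A : Fin n → X × Z, F (update A i a) ≤ ∑ _A : Fin n → X × Z, M :=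
    Finset.sum_le_sum fun A _ => h _
  have h2 : (0 : ℝ) < Fintype.card (X × Z) := by exact_mod_cast Fintype.card_pos
  rw [inv_pow, inv_mul_le_iff₀ (by positivity)]
  classical
  simpa using h1

theorem expect_nonneg [Nonempty (X × Z)] (hD : G.D = PMF.uniformOfFintype _) (i : Fin n)
    (a : X × Z) (F : (Fin n → X × Z) → ℝ) (h : ∀ A, 0 ≤ F A) : 0 ≤ G.expect i a F := by
  rw [expect_of_uniform hD]
  exact mul_nonneg (by positivity) (Finset.sum_nonneg fun A _ => h _)

/-- Overwriting coordinate `i` forgets its draw, so each profile with `A i = a` arises from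
`Fintype.card T` profiles. -/
theorem sum_update {T : Type} [Fintype T] [DecidableEq T] (i : Fin n) (a : T) (F : (Fin n → T) → ℝ) :
    ∑ A : Fin n → T, F (update A i a) =
      Fintype.card T * ∑ A : Fin n → T, if A i = a then F A else 0 := by
  cases n with
  | zero => exact i.elim0
  | succ n =>
    rw [← (Fin.insertNthEquiv (fun _ => T) i).sum_comp,
      ← (Fin.insertNthEquiv (fun _ => T) i).sum_comp, Fintype.sum_prod_type, Fintype.sum_prod_type,
      Finset.sum_comm (γ := T)]
    simp [Fin.insertNthEquiv, Fin.update_insertNth, Finset.mul_sum]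

theorem expect_eq_sum_ite [Nonempty (X × Z)] [DecidableEq (X × Z)] (hD : G.D = PMF.uniformOfFintype _) (i : Fin n)
    (a : X × Z) (F : (Fin n → X × Z) → ℝ) :
    G.expect i a F = ((Fintype.card (X × Z) : ℝ)⁻¹) ^ n * (Fintype.card (X × Z) *
      ∑ A : Fin n → X × Z, if A i = a then F A else 0) := by
  rw [expect_of_uniform hD, ← sum_update]

end Expectation

section Alloc

variable {X Z : Type} {n : ℕ} (G : AuditGame X Z) (A : Fin n → X × Z)

theorem alloc_nonneg (i : Fin n) : 0 ≤ G.alloc A i := le_max_left _ _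

theorem alloc_le_one (i : Fin n) : G.alloc A i ≤ 1 := max_le zero_le_one (min_le_left _ _)

theorem alloc_congr {i j : Fin n} (h : A i = A j) : G.alloc A i = G.alloc A j := by
  simp [alloc, h]

theorem alloc_comp_perm (π : Equiv.Perm (Fin n)) (i : Fin n) :
    G.alloc (A ∘ π) i = G.alloc A (π i) := by
  have h (P : Fin n → Prop) : {j | P (π j)}.ncard = {j | P j}.ncard :=
    Set.ncard_preimage_of_injective_subset_range π.injective
      (by rw [π.surjective.range_eq]; exact Set.subset_univ _)
  simp only [alloc, comp_apply]
  rw [h fun j => G.f (A (π i)) < G.f (A j), h fun j => G.f (A j) = G.f (A (π i))]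

end Alloc

section SharePolicy

variable {X Z : Type} {n : ℕ} {G : AuditGame X Z}

open Classical in
/-- Share the budget among the agents who report `b`. -/
noncomputable def sharePolicy (G : AuditGame X Z) (b : X × Z) (A : Fin n → X × Z) (i : Fin n) : ℝ :=
  if A i = b then G.B / #{j | A j = b} else 0

open Classical in
theorem sum_sharePolicy (b : X × Z) (A : Fin n → X × Z) {i : Fin n} (hi : A i = b) :
    ∑ j, (if A j = b then G.sharePolicy b A j else 0) = G.B := by
  have : (#{j | A j = b} : ℝ) ≠ 0 := by
    exact_mod_cast (Finset.card_pos.2 ⟨i, by simpa using hi⟩).ne'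
  have h (j : Fin n) : (if A j = b then G.sharePolicy b A j else 0) =
      if A j = b then G.B / #{j | A j = b} else 0 := by
    simp only [sharePolicy]; split <;> rfl
  rw [Finset.sum_congr rfl fun j _ => h j, ← Finset.sum_filter, Finset.sum_const, nsmul_eq_mul]
  field_simp

theorem sharePolicy_isAuditPolicy (hB₀ : 0 ≤ G.B) (hB₁ : G.B ≤ 1) (b : X × Z) :
    G.IsAuditPolicy (n := n) (G.sharePolicy b) := by
  classical
  refine ⟨fun A i => ?_, fun A i => ?_, fun A => ?_⟩
  · unfold sharePolicy; split <;> positivity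
  · unfold sharePolicy
    split
    · next h =>
      have : (1 : ℝ) ≤ #{j | A j = b} := by
        exact_mod_cast (Finset.card_pos.2 ⟨i, by simpa using h⟩)
      exact (div_le_self hB₀ this).trans hB₁
    · exact zero_le_one
  · by_cases h : ∃ i, A i = b
    · obtain ⟨i, hi⟩ := h
      rw [← sum_sharePolicy (G := G) b A hi]
      refine le_of_eq (Finset.sum_congr rfl fun j _ => ?_)
      simp only [sharePolicy]; split <;> rfl
    · push Not at h
      simpa [sharePolicy, h] using hB₀

/-- At each profile, no policy makes the agents who report `b` lose more than `sharePolicy` does. -/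
theorem sum_audit_le [DecidableEq (X × Z)] {φ : (Fin n → X × Z) → Fin n → ℝ}
    (hφ : G.IsAuditPolicy φ) (hc : 0 ≤ G.c) (b : X × Z) (A : Fin n → X × Z) :
    ∑ i, (if A i = b then φ A i * (G.alloc A i + G.c) else 0) ≤
      ∑ i, (if A i = b then G.sharePolicy b A i * (G.alloc A i + G.c) else 0) := by
  by_cases h : ∃ i, A i = b
  · obtain ⟨i, hi⟩ := h
    have key (ψ : (Fin n → X × Z) → Fin n → ℝ) :
        ∑ j, (if A j = b then ψ A j * (G.alloc A j + G.c) else 0) =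
          (∑ j, if A j = b then ψ A j else 0) * (G.alloc A i + G.c) := by
      rw [Finset.sum_mul]
      refine Finset.sum_congr rfl fun j _ => ?_
      split
      · next hj => rw [G.alloc_congr A (hj.trans hi.symm)]
      · simp
    have hs : ∑ j, (if A j = b then G.sharePolicy b A j else 0) = G.B := by
      convert sum_sharePolicy b A hi
    rw [key φ, key (G.sharePolicy b), hs]
    refine mul_le_mul_of_nonneg_right ?_ (add_nonneg (G.alloc_nonneg A i) hc)
    refine le_trans (Finset.sum_le_sum fun j _ => ?_) (hφ.budget A)
    split
    · exact le_rfl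
    · exact hφ.nonneg A j
  · push Not at h
    simp [h]

end SharePolicy

section Optimal

variable {X Z : Type} [Fintype X] [Fintype Z] {n : ℕ} {G : AuditGame X Z}

/-- The expected loss through audits of an agent who lies by reporting `b`. -/
noncomputable def auditLoss (G : AuditGame X Z) (φ : (Fin n → X × Z) → Fin n → ℝ) (i : Fin n)
    (b : X × Z) : ℝ :=
  G.expect i b fun A => φ A i * (G.alloc A i + G.c)

theorem utility_of_ne (φ : (Fin n → X × Z) → Fin n → ℝ) (i : Fin n) {a b : X × Z} (h : b ≠ a) :
    G.utility φ i a b = G.chance i b - G.auditLoss φ i b := by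
  unfold utility chance auditLoss
  rw [if_neg h, ← expect_sub]
  congr 1
  funext A
  ring

theorem utility_self (φ : (Fin n → X × Z) → Fin n → ℝ) (i : Fin n) (a : X × Z) :
    G.utility φ i a a = G.chance i a := by
  unfold utility chance
  rw [if_pos rfl]

/-- Swapping the agents `i` and `j` is a bijection of profiles that preserves the policy, the
allocation and the uniform weights. -/
theorem auditLoss_sharePolicy [Nonempty (X × Z)] (hD : G.D = PMF.uniformOfFintype _) (b : X × Z)
    (i j : Fin n) : G.auditLoss (G.sharePolicy b) i b = G.auditLoss (G.sharePolicy b) j b := by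
  classical
  unfold auditLoss
  rw [expect_eq_sum_ite hD, expect_eq_sum_ite hD]
  congr 2
  rw [← ((Equiv.swap i j).arrowCongr (Equiv.refl (X × Z))).sum_comp]
  refine Finset.sum_congr rfl fun A _ => ?_
  have hA : (Equiv.swap i j).arrowCongr (Equiv.refl (X × Z)) A = A ∘ Equiv.swap i j := by
    funext k; simp
  have hcard : #{k | (A ∘ Equiv.swap i j) k = b} = #{k | A k = b} :=
    Finset.card_bij (fun k _ => Equiv.swap i j k) (by simp) (by simp)
      (fun k hk => ⟨Equiv.swap i j k, by simpa using hk, by simp⟩)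
  rw [hA, alloc_comp_perm]
  unfold sharePolicy
  rw [hcard]
  simp

/-- The total loss of the lies `b` is a weighted sum over profiles. -/
theorem sum_auditLoss [Nonempty (X × Z)] [DecidableEq (X × Z)]
    (hD : G.D = PMF.uniformOfFintype _) (φ : (Fin n → X × Z) → Fin n → ℝ) (b : X × Z) :
    ∑ i, G.auditLoss φ i b = ((Fintype.card (X × Z) : ℝ)⁻¹) ^ n * (Fintype.card (X × Z) *
      ∑ A : Fin n → X × Z, ∑ i, if A i = b then φ A i * (G.alloc A i + G.c) else 0) := by
  rw [Finset.sum_comm, Finset.mul_sum, Finset.mul_sum]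
  refine Finset.sum_congr rfl fun i _ => ?_
  unfold auditLoss
  rw [expect_eq_sum_ite hD]

variable [Nonempty (X × Z)] {C : X × Z → ℝ} {a b : X × Z}

/-- The hypothesis that a single lie, reporting `b` instead of `a`, is more profitable than all
others by such a margin that the whole budget is needed for it. -/
structure IsDominantLie (G : AuditGame X Z) (n : ℕ) (C : X × Z → ℝ) (a b : X × Z) : Prop where
  uniform : G.D = PMF.uniformOfFintype _
  budget_pos : 0 < G.B
  budget_le : G.B ≤ 1
  fine_pos : 0 < G.c
  chance_eq : ∀ (i : Fin n) t, G.chance i t = C t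
  same_known : b.1 = a.1
  ne : b ≠ a
  gap : ∀ a' b', b'.1 = a'.1 → (a' ≠ a ∨ b' ≠ b) →
    C b' - C a' ≤ C b - C a - G.B * (1 + G.c)

/-- An audit policy takes at most `B(1 + c)` from the dominant lie, so that even after the audits it
gains at least as much as any other lie gains unaudited. The agent `i₀` is only a reference point,
all agents suffering the same loss. -/
theorem IsDominantLie.sharePolicy_isBNIC (h : G.IsDominantLie n C a b) (i₀ : Fin n) :
    G.IsBNIC (n := n) (G.sharePolicy b) (C b - C a - G.auditLoss (G.sharePolicy b) i₀ b) := by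
  have hpol := sharePolicy_isAuditPolicy (n := n) h.budget_pos.le h.budget_le b
  have hle (A : Fin n → X × Z) (i : Fin n) : G.sharePolicy b A i ≤ G.B :=
    (Finset.single_le_sum (fun j _ => hpol.nonneg A j) (Finset.mem_univ i)).trans (hpol.budget A)
  have hM : G.auditLoss (G.sharePolicy b) i₀ b ≤ G.B * (1 + G.c) :=
    expect_le_of_le h.uniform _ _ _ fun A =>
      mul_le_mul (hle A i₀) (by linarith [G.alloc_le_one A i₀])
        (add_nonneg (G.alloc_nonneg A i₀) h.fine_pos.le) h.budget_pos.le
  intro i a' b' _ hk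
  rw [utility_self, h.chance_eq]
  by_cases hab : a' = a ∧ b' = b
  · obtain ⟨rfl, rfl⟩ := hab
    rw [utility_of_ne _ _ h.ne, h.chance_eq, auditLoss_sharePolicy h.uniform b' i i₀]
    linarith
  · have hg := h.gap a' b' hk (by tauto)
    by_cases hb : b' = a'
    · subst hb
      rw [utility_self, h.chance_eq]
      linarith
    · rw [utility_of_ne _ _ hb, h.chance_eq]
      have : 0 ≤ G.auditLoss (G.sharePolicy b) i b' :=
        expect_nonneg h.uniform _ _ _ fun A => mul_nonneg (hpol.nonneg A i)
          (add_nonneg (G.alloc_nonneg A i) h.fine_pos.le)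
      linarith

theorem IsDominantLie.auditLoss_ge (h : G.IsDominantLie n C a b)
    {φ : (Fin n → X × Z) → Fin n → ℝ} {ε : ℝ} (hφ : G.IsBNIC φ ε) (i : Fin n) :
    C b - C a - ε ≤ G.auditLoss φ i b := by
  have := hφ i a b (by rw [h.uniform]; exact (PMF.mem_support_iff _ _).1 (by simp)) h.same_known
  rw [utility_self, utility_of_ne _ _ h.ne, h.chance_eq, h.chance_eq] at this
  linarith

/-- Summed over agents, the loss becomes a sum over profiles. In each profile those who report `b`
have equal allocations, so only the total budget spent on them counts, and `sharePolicy` spends all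
of it. -/
theorem IsDominantLie.sum_auditLoss_le (h : G.IsDominantLie n C a b)
    {φ : (Fin n → X × Z) → Fin n → ℝ} (hφ : G.IsAuditPolicy φ) (i₀ : Fin n) :
    ∑ i, G.auditLoss φ i b ≤ n * G.auditLoss (G.sharePolicy b) i₀ b := by
  classical
  have : ∑ i : Fin n, G.auditLoss (G.sharePolicy b) i b = n * G.auditLoss (G.sharePolicy b) i₀ b := by
    rw [Finset.sum_congr rfl fun i _ => auditLoss_sharePolicy h.uniform b i i₀]
    simp
  rw [← this, sum_auditLoss h.uniform, sum_auditLoss h.uniform]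
  exact mul_le_mul_of_nonneg_left (mul_le_mul_of_nonneg_left
    (Finset.sum_le_sum fun A _ => sum_audit_le hφ h.fine_pos.le b A) (by positivity))
    (by positivity)

/-- Any competing policy must inflict the required loss on every agent, hence on average, and the
average loss is largest for `sharePolicy`. -/
theorem IsDominantLie.sharePolicy_isOptimal [NeZero n] (h : G.IsDominantLie n C a b) :
    G.IsOptimal (n := n) (G.sharePolicy b) := by
  refine ⟨sharePolicy_isAuditPolicy h.budget_pos.le h.budget_le b, _,
    h.sharePolicy_isBNIC 0, fun ψ δ hψ hδ => ?_⟩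
  have h1 := h.sum_auditLoss_le hψ 0
  have h2 := Finset.sum_le_sum fun i (_ : i ∈ Finset.univ) => h.auditLoss_ge hδ i
  have hn : (0 : ℝ) < n := by exact_mod_cast Nat.pos_of_ne_zero (NeZero.ne n)
  simp only [Finset.sum_const, Finset.card_univ, Fintype.card_fin, nsmul_eq_mul] at h2
  have := le_of_mul_le_mul_left (h2.trans h1) hn
  linarith

/-- Every optimal policy spends the whole budget on the single agent who reports `b`. -/
theorem IsDominantLie.eq_budget_of_isOptimal (h : G.IsDominantLie n C a b)
    {φ : (Fin n → X × Z) → Fin n → ℝ} (hφ : G.IsOptimal φ) {A : Fin n → X × Z} {i : Fin n}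
    (hi : A i = b) (hA : ∀ j, j ≠ i → A j ≠ b) (j : Fin n) :
    φ A j = if j = i then G.B else 0 := by
  classical
  obtain ⟨hpol, ε, hε, hmin⟩ := hφ
  have hε' := hmin _ _ (sharePolicy_isAuditPolicy h.budget_pos.le h.budget_le b)
    (h.sharePolicy_isBNIC i)
  have h1 : ∑ j : Fin n, G.auditLoss (G.sharePolicy b) j b ≤ ∑ j, G.auditLoss φ j b := by
    refine Finset.sum_le_sum fun j _ => ?_
    rw [auditLoss_sharePolicy h.uniform b j i]
    linarith [h.auditLoss_ge hε j]
  have hN : (0 : ℝ) < Fintype.card (X × Z) := by exact_mod_cast Fintype.card_pos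
  rw [sum_auditLoss h.uniform, sum_auditLoss h.uniform,
    mul_le_mul_iff_of_pos_left (by positivity), mul_le_mul_iff_of_pos_left hN] at h1
  -- The two sums over profiles agree while each term is at most its counterpart, so the terms
  -- agree, in particular at the given profile.
  have h2 := (Finset.sum_eq_sum_iff_of_le fun A _ =>
    sum_audit_le hpol h.fine_pos.le b A).1 (le_antisymm
      (Finset.sum_le_sum fun A _ => sum_audit_le hpol h.fine_pos.le b A) h1) A (Finset.mem_univ A)
  have h3 : #{j | A j = b} = 1 := Finset.card_eq_one.2 ⟨i, by
    ext j
    by_cases hj : j = i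
    · simp [hj, hi]
    · simp [hj, hA j hj]⟩
  have hsum (ψ : (Fin n → X × Z) → Fin n → ℝ) :
      ∑ j, (if A j = b then ψ A j * (G.alloc A j + G.c) else 0) =
        ψ A i * (G.alloc A i + G.c) := by
    rw [Finset.sum_eq_single i (fun j _ hj => if_neg (hA j hj)) (by simp), if_pos hi]
  have hs : G.sharePolicy b A i = G.B := by simp [sharePolicy, hi, h3]
  have hφi : φ A i = G.B := by
    rw [hsum, hsum, hs] at h2
    -- The positive fine makes the factor cancellable even if the allocation vanishes.
    exact mul_right_cancel₀
      (add_pos_of_nonneg_of_pos (G.alloc_nonneg A i) h.fine_pos).ne' h2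
  split
  · next hj => rw [hj, hφi]
  · next hj =>
    have := hpol.budget A
    have h4 : φ A j + φ A i ≤ ∑ k, φ A k := by
      rw [← Finset.sum_pair hj]
      exact Finset.sum_le_sum_of_subset_of_nonneg (Finset.subset_univ _)
        fun k _ _ => hpol.nonneg A k
    linarith [hpol.nonneg A j]

end Optimal

end AuditGame

/-! ### Chances with four agents and three resources. -/

namespace AuditGame

open Function Finset

/-- When all agents but one receive a resource, an agent goes without it only if nobody reports a
lower score, and then with a chance depending on the number of ties. -/
theorem alloc_eq_one_sub {X Z : Type} {n : ℕ} (G : AuditGame X Z) (hk : G.k + 1 = n)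
    (A : Fin n → X × Z) (i : Fin n) :
    G.alloc A i = 1 - (∏ j, if G.f (A i) ≤ G.f (A j) then (1 : ℝ) else 0) /
      ∑ j, if G.f (A j) = G.f (A i) then (1 : ℝ) else 0 := by
  classical
  have hk' : (G.k : ℝ) = n - 1 := by rw [← hk]; push_cast; ring
  unfold alloc
  rw [Set.ncard_eq_toFinset_card', Set.ncard_eq_toFinset_card', Set.toFinset_ofPred,
    Set.toFinset_ofPred, hk', Finset.sum_boole]
  have he : 0 < #{j | G.f (A j) = G.f (A i)} := Finset.card_pos.2 ⟨i, by simp⟩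
  have he' : (0 : ℝ) < #{j | G.f (A j) = G.f (A i)} := by exact_mod_cast he
  have hun : #{j | G.f (A i) < G.f (A j)} + #{j | G.f (A j) = G.f (A i)} =
      #{j | G.f (A i) ≤ G.f (A j)} := by
    rw [← Finset.card_union_of_disjoint]
    · congr 1
      ext j
      simp [le_iff_lt_or_eq, eq_comm]
    · exact Finset.disjoint_filter.2 fun j _ h h' => h.ne' h'
  by_cases h : ∀ j, G.f (A i) ≤ G.f (A j)
  · have hall : #{j | G.f (A i) ≤ G.f (A j)} = n := by simp [h]
    rw [Finset.prod_congr rfl fun j _ => if_pos (h j), Finset.prod_const_one]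
    have hgt : (#{j | G.f (A i) < G.f (A j)} : ℝ) = n - #{j | G.f (A j) = G.f (A i)} := by
      rw [eq_sub_iff_add_eq]; exact_mod_cast hun.trans hall
    have hq : ((n : ℝ) - 1 - #{j | G.f (A i) < G.f (A j)}) / #{j | G.f (A j) = G.f (A i)} =
        1 - 1 / #{j | G.f (A j) = G.f (A i)} := by
      rw [hgt]; field_simp; ring
    have h1 : (1 : ℝ) / #{j | G.f (A j) = G.f (A i)} ≤ 1 := by
      rw [div_le_one he']; exact_mod_cast he
    have h2 : (0 : ℝ) ≤ 1 / #{j | G.f (A j) = G.f (A i)} := by positivity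
    rw [hq, min_eq_right (by linarith), max_eq_right (by linarith)]
  · push Not at h
    obtain ⟨j, hj⟩ := h
    rw [Finset.prod_eq_zero (Finset.mem_univ j) (if_neg hj.not_ge), zero_div, sub_zero]
    have hlt : #{j | G.f (A i) ≤ G.f (A j)} < n := by
      conv_rhs => rw [← Fintype.card_fin n]
      exact Finset.card_lt_univ_of_notMem (x := j) (by simpa using hj)
    have hge : (1 : ℝ) ≤ ((n : ℝ) - 1 - #{j | G.f (A i) < G.f (A j)}) /
        #{j | G.f (A j) = G.f (A i)} := by
      rw [le_div_iff₀ he', one_mul, le_sub_iff_add_le, le_sub_iff_add_le]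
      norm_cast
      omega
    rw [min_eq_left hge, max_eq_right zero_le_one]

/-- The indicator of the numbers above `y` plus `s` times that of `y`. -/
noncomputable def aboveWeight (y s x : ℝ) : ℝ :=
  (if y < x then 1 else 0) + s * if x = y then 1 else 0

/-- Simpson's rule expresses the share of an agent in a tie through products. -/
theorem tie_share_eq (y x₁ x₂ x₃ : ℝ) :
    (if y ≤ x₁ then (1 : ℝ) else 0) * (if y ≤ x₂ then 1 else 0) * (if y ≤ x₃ then 1 else 0) /
        (1 + (if x₁ = y then 1 else 0) + (if x₂ = y then 1 else 0) + (if x₃ = y then 1 else 0)) =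
      (aboveWeight y 0 x₁ * aboveWeight y 0 x₂ * aboveWeight y 0 x₃ +
        4 * (aboveWeight y (1 / 2) x₁ * aboveWeight y (1 / 2) x₂ * aboveWeight y (1 / 2) x₃) +
        aboveWeight y 1 x₁ * aboveWeight y 1 x₂ * aboveWeight y 1 x₃) / 6 := by
  -- With `e` ties among the others the share is `1 / (1 + e)`, the integral of `s ^ e` over `[0,
  -- 1]`. As `e ≤ 3`, Simpson's rule with nodes `0`, `1/2`, `1` is exact, and `s ^ e` is a product
  -- with one factor per other agent. The identity is checked on the 27 order patterns.
  have key (x : ℝ) : (y ≤ x ∧ y < x ∧ x ≠ y) ∨ (y ≤ x ∧ ¬ y < x ∧ x = y) ∨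
      (¬ y ≤ x ∧ ¬ y < x ∧ x ≠ y) := by
    rcases lt_trichotomy y x with h | h | h
    · exact .inl ⟨h.le, h, h.ne'⟩
    · exact .inr (.inl ⟨h.le, h.not_lt, h.symm⟩)
    · exact .inr (.inr ⟨h.not_ge, h.not_gt, h.ne⟩)
  unfold aboveWeight
  rcases key x₁ with ⟨a₁, b₁, c₁⟩ | ⟨a₁, b₁, c₁⟩ | ⟨a₁, b₁, c₁⟩ <;>
  rcases key x₂ with ⟨a₂, b₂, c₂⟩ | ⟨a₂, b₂, c₂⟩ | ⟨a₂, b₂, c₂⟩ <;>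
  rcases key x₃ with ⟨a₃, b₃, c₃⟩ | ⟨a₃, b₃, c₃⟩ | ⟨a₃, b₃, c₃⟩ <;>
  simp only [a₁, b₁, c₁, a₂, b₂, c₂, a₃, b₃, c₃, if_true, if_false] <;> norm_num

/-- Independence turns the expectation of a product over the other three agents into a cube; the
free coordinate `i` contributes the number of types. Applied at the three Simpson nodes, this
integrates `(u + s(v - u))³` over `s`, which is a quarter of `cubicMean v u`. -/
theorem sum_prod_others {T : Type} [Fintype T] (g : T → ℝ) (i : Fin 4) :
    ∑ A : Fin 4 → T, ∏ j, (if j = i then 1 else g (A j)) =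
      Fintype.card T * (∑ t, g t) ^ 3 := by
  have := Fintype.prod_sum fun (j : Fin 4) (t : T) => if j = i then 1 else g t
  rw [← this, Finset.prod_congr rfl fun j _ => show _ = if j = i then (Fintype.card T : ℝ) else
    ∑ t, g t by split <;> simp]
  fin_cases i <;> simp [Fin.prod_univ_four] <;> ring

theorem alloc_update_eq {X Z : Type} (G : AuditGame X Z) (hk : G.k = 3)
    (A : Fin 4 → X × Z) (i : Fin 4) (b : X × Z) :
    G.alloc (update A i b) i = 1 -
      ((∏ j, if j = i then 1 else aboveWeight (G.f b) 0 (G.f (A j))) +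
        4 * (∏ j, if j = i then 1 else aboveWeight (G.f b) (1 / 2) (G.f (A j))) +
        ∏ j, if j = i then 1 else aboveWeight (G.f b) 1 (G.f (A j))) / 6 := by
  rw [alloc_eq_one_sub G (by rw [hk]), update_self]
  congr 1
  fin_cases i
  · rw [Fin.prod_univ_four, Fin.sum_univ_four]
    simpa [Fin.prod_univ_four, update, add_assoc] using
      tie_share_eq (G.f b) (G.f (A 1)) (G.f (A 2)) (G.f (A 3))
  · rw [Fin.prod_univ_four, Fin.sum_univ_four]
    simpa [Fin.prod_univ_four, update, add_comm, add_left_comm, add_assoc] using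
      tie_share_eq (G.f b) (G.f (A 0)) (G.f (A 2)) (G.f (A 3))
  · rw [Fin.prod_univ_four, Fin.sum_univ_four]
    simpa [Fin.prod_univ_four, update, add_comm, add_left_comm, add_assoc] using
      tie_share_eq (G.f b) (G.f (A 0)) (G.f (A 1)) (G.f (A 3))
  · rw [Fin.prod_univ_four, Fin.sum_univ_four]
    simpa [Fin.prod_univ_four, update, add_comm, add_left_comm, add_assoc] using
      tie_share_eq (G.f b) (G.f (A 0)) (G.f (A 1)) (G.f (A 2))

/-- `v³ + v²u + vu² + u³`. -/
def cubicMean (v u : ℝ) : ℝ := v ^ 3 + v ^ 2 * u + v * u ^ 2 + u ^ 3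

variable {X Z : Type} [Fintype X] [Fintype Z] {G : AuditGame X Z}

/-- The chance of an agent, among four agents competing for three resources, in terms of the numbers
of types with at least, respectively more than, the score reported. -/
theorem chance_eq_cubicMean [Nonempty (X × Z)] (hD : G.D = PMF.uniformOfFintype _) (hk : G.k = 3)
    (i : Fin 4) (b : X × Z) :
    G.chance i b = 1 - cubicMean #{t | G.f b ≤ G.f t} #{t | G.f b < G.f t} /
      (4 * (Fintype.card (X × Z) : ℝ) ^ 3) := by
  classical
  have hN : (Fintype.card (X × Z) : ℝ) ≠ 0 := by exact_mod_cast Fintype.card_ne_zero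
  have hs (s : ℝ) : ∑ t : X × Z, aboveWeight (G.f b) s (G.f t) =
      #{t | G.f b < G.f t} + s * #{t | G.f t = G.f b} := by
    simp only [aboveWeight, Finset.sum_add_distrib, ← Finset.mul_sum, Finset.sum_boole]
  have hun : (#{t | G.f b ≤ G.f t} : ℝ) = #{t | G.f b < G.f t} + #{t | G.f t = G.f b} := by
    norm_cast
    rw [← Finset.card_union_of_disjoint]
    · congr 1
      ext j
      simp [le_iff_lt_or_eq, eq_comm]
    · exact Finset.disjoint_filter.2 fun j _ h h' => h.ne' h'
  unfold chance
  rw [expect_of_uniform hD, Finset.sum_congr rfl fun A _ => alloc_update_eq G hk A i b,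
    Finset.sum_sub_distrib, ← Finset.sum_div, Finset.sum_add_distrib, Finset.sum_add_distrib,
    ← Finset.mul_sum, sum_prod_others fun t => aboveWeight (G.f b) 0 (G.f t),
    sum_prod_others fun t => aboveWeight (G.f b) (1 / 2) (G.f t),
    sum_prod_others fun t => aboveWeight (G.f b) 1 (G.f t), hs, hs, hs, hun, cubicMean]
  simp only [Finset.sum_const, Finset.card_univ, Fintype.card_pi, Finset.prod_const,
    Fintype.card_fin, nsmul_eq_mul]
  push_cast
  field_simp
  ring

theorem cubicMean_mono {v u v' u' : ℝ} (hu : 0 ≤ u) (huu : u ≤ u') (hv : 0 ≤ v) (hvv : v ≤ v') :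
    cubicMean v u ≤ cubicMean v' u' := by
  have := hv.trans hvv
  unfold cubicMean
  gcongr

/-- The value `cubicMean u' u'` separates the two sides. In the application `v ≤ u'` because whoever
scores at least the higher score exceeds the lower one. -/
theorem cubicMean_lt {v u v' u' : ℝ} (hu : 0 ≤ u) (huv : u ≤ v) (hv : v ≤ u') (h : u' < v') :
    cubicMean v u < cubicMean v' u' := by
  have h0 : 0 ≤ v := hu.trans huv
  have h1 : cubicMean v u ≤ cubicMean u' u' := cubicMean_mono hu (huv.trans hv) h0 hv
  refine h1.trans_lt ?_
  have h2 : 0 ≤ u' := h0.trans hv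
  unfold cubicMean
  have h3 : u' ^ 3 < v' ^ 3 := pow_lt_pow_left₀ h h2 (by norm_num)
  have h4 : u' ^ 2 * u' ≤ v' ^ 2 * u' := by gcongr
  have h5 : u' * u' ^ 2 ≤ v' * u' ^ 2 := by gcongr
  linarith

/-- Together with `chance_congr` this reduces suspicion to a comparison of scores. -/
theorem chance_lt_chance [Nonempty (X × Z)] (hD : G.D = PMF.uniformOfFintype _) (hk : G.k = 3)
    (i : Fin 4) {a b : X × Z} (h : G.f a < G.f b) : G.chance i a < G.chance i b := by
  have hN : (0 : ℝ) < Fintype.card (X × Z) := by exact_mod_cast Fintype.card_pos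
  rw [chance_eq_cubicMean hD hk, chance_eq_cubicMean hD hk, sub_lt_sub_iff_left,
    div_lt_div_iff_of_pos_right (by positivity)]
  refine cubicMean_lt (by positivity) ?_ ?_ ?_ <;> norm_cast
  · exact Finset.card_le_card fun t => by simpa using le_of_lt
  · exact Finset.card_le_card fun t => by simpa using h.trans_le
  · refine Finset.card_lt_card ⟨fun t => by simpa using le_of_lt, fun hs => ?_⟩
    simpa using @hs a (by simp)

theorem chance_congr [Nonempty (X × Z)] (hD : G.D = PMF.uniformOfFintype _) (hk : G.k = 3)
    (i : Fin 4) {a b : X × Z} (h : G.f a = G.f b) : G.chance i a = G.chance i b := by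
  rw [chance_eq_cubicMean hD hk, chance_eq_cubicMean hD hk, h]

end AuditGame

/-! ### Programs judged by their output on stack 0. -/

namespace StackProg

open Function

/-- The store that holds the strings of a list on its first stacks. -/
def st (L : List (List Bool)) : Store := fun j => L.getD j []

theorem update_st {L : List (List Bool)} {i : ℕ} (h : i < L.length) (l : List Bool) :
    update (st L) i l = st (L.set i l) := by
  funext j
  rcases eq_or_ne j i with rfl | hj
  · simp [st, h]
  · simp [st, update_of_ne hj, List.getElem?_set_ne hj.symm]

/-- From the store `σ`, the program halts within `T` steps with `l` on stack `0`. -/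
def Outputs (p : StackProg) (σ : Store) (T : ℕ) (l : List Bool) : Prop :=
  ∃ σ', Runs p σ σ' T ∧ σ' 0 = l

section Outputs

variable {p q e : StackProg} {σ σ' : Store} {r T T' T₁ T₂ : ℕ} {l l' : List Bool}

theorem Outputs.mono (h : Outputs p σ T l) (hT : T ≤ T') : Outputs p σ T' l :=
  let ⟨σ', h, h'⟩ := h; ⟨σ', h.mono hT, h'⟩

theorem Runs.seq_outputs (h₁ : Runs p σ σ' T₁) (h₂ : Outputs q σ' T₂ l) :
    Outputs (StackProg.seq p q) σ (T₁ + T₂ + 1) l :=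
  let ⟨_, h, h'⟩ := h₂; ⟨_, h₁.seq h, h'⟩

theorem Outputs.test_true (hr : σ r = true :: l') (h : Outputs p σ T l) :
    Outputs (test r p q e) σ (T + 1) l :=
  let ⟨_, h, h'⟩ := h; ⟨_, h.test_true hr, h'⟩

theorem Outputs.test_false (hr : σ r = false :: l') (h : Outputs q σ T l) :
    Outputs (test r p q e) σ (T + 1) l :=
  let ⟨_, h, h'⟩ := h; ⟨_, h.test_false hr, h'⟩

theorem Outputs.test_nil (hr : σ r = []) (h : Outputs e σ T l) :
    Outputs (test r p q e) σ (T + 1) l :=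
  let ⟨_, h, h'⟩ := h; ⟨_, h.test_nil hr, h'⟩

end Outputs

/-- Output the string `l`. -/
def out (l : List Bool) : StackProg := seq (clear 0) (pushes 0 l)

theorem outputs_out {l : List Bool} {σ : Store} {T : ℕ} (h : (σ 0).length ≤ T) :
    Outputs (out l) σ (2 * T + 2 * l.length + 3) l :=
  ⟨_, (runs_clear.seq runs_pushes).mono (by omega), by simp⟩

end StackProg

/-! ### The score function -/

/-- Some pair of consecutive bits is `11`. -/
def hasBoth : List Bool → Bool
  | p :: q :: r => (p && q) || hasBoth r
  | _ => false

/-- Some pair of consecutive bits is `00`. -/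
def hasNone : List Bool → Bool
  | p :: q :: r => (!p && !q) || hasNone r
  | _ => false

/-- The bits coded by the pairs `10` (for `1`) and `01` (for `0`). -/
def pairBits : List Bool → List Bool
  | p :: q :: r => if p = q then pairBits r else p :: pairBits r
  | _ => []

/-- The string `c` that is coded as `c ++ 1 ++ 0…0`. -/
def unpad (u : List Bool) : List Bool := ((u.reverse.dropWhile (!·)).tail).reverse

/-- The score of the types whose known part may contain a certificate. -/
def certScore (V : List Bool → Bool) (r : List Bool) : ℕ :=
  if hasBoth r then 7 else if hasNone r then 3 else if V (unpad (pairBits r)) then 5 else 3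

/-- The score of the known part `x` and the self-reported bit `z`, where `V` decides which
certificates are valid. -/
def listScore (V : List Bool → Bool) : List Bool → Bool → ℕ
  | true :: true :: _ :: _, _ => 8
  | true :: false :: true :: r, _ => certScore V r
  | true :: false :: false :: _, _ => 3
  | false :: true :: g :: r, z =>
      if r.any id then (if z then 8 else 7)
      else if g then (if z then 6 else 2) else (if z then 4 else 1)
  | false :: false :: _ :: _, _ => 0
  | _, _ => 0

theorem pairBits_length_le (r : List Bool) : 2 * (pairBits r).length ≤ r.length := by
  induction r using pairBits.induct with
  | case1 p r ih => simp [pairBits]; omega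
  | case2 p q r h ih => simp [pairBits, h]; omega
  | case3 r h => simp [pairBits]

theorem unpad_length_le (u : List Bool) : (unpad u).length ≤ u.length - 1 := by
  have := (List.dropWhile_sublist (l := u.reverse) (!·)).length_le
  simp [unpad] at this ⊢
  omega

theorem unpad_append (c : List Bool) (j : ℕ) :
    unpad (c ++ true :: List.replicate j false) = c := by
  have : ∀ l : List Bool, (List.replicate j false ++ true :: l).dropWhile (!·) = true :: l := by
    intro l
    induction j with
    | zero => simp
    | succ j ih => simp [List.replicate_succ, ih]
  simp [unpad, this]

/-! ### The program that computes the score. -/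

namespace StackProg

open Function

/-- The binary digits of a number below `16`, least significant first. -/
def digits (v : ℕ) : List Bool := [v.testBit 0, v.testBit 1, v.testBit 2, v.testBit 3]

/-- Record on stack `2` whether stack `0` contains `1`, and empty the latter. -/
def anyProg : StackProg := loop 0 (test 0 (seq (pop 0) (push 2 true)) (pop 0) skip)

/-- Stack 2 serves as a flag: only its being empty or not matters, so its height is left
existential. -/
theorem runs_anyProg (r z b c w : List Bool) (i : ℕ) :
    ∃ i', Runs anyProg (st [r, z, List.replicate i true, b, c, w])
      (st [[], z, List.replicate i' true, b, c, w]) (5 * r.length + 1) ∧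
      (i' = 0 ↔ i = 0 ∧ r.any id = false) := by
  induction r generalizing i with
  | nil => exact ⟨i, runs_loop_nil rfl, by simp⟩
  | cons p r ih =>
    cases p
    · obtain ⟨i', h, h'⟩ := ih i
      refine ⟨i', (Runs.loop_cons rfl (Runs.test_false rfl (runs_pop.of_eq ?_ le_rfl)) h).mono
        (by simp; omega), by simp [h']⟩
      rw [update_st (by simp)]; rfl
    · obtain ⟨i', h, h'⟩ := ih (i + 1)
      refine ⟨i', (Runs.loop_cons rfl (Runs.test_true rfl
        ((runs_pop.seq runs_push).of_eq ?_ le_rfl)) h).mono (by simp; omega), by simp [h']⟩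
      rw [update_st (by simp), update_st (by simp)]; rfl

/-- Read stack `0` in pairs, recording pairs `00` on stack `2`, pairs `11` on stack `3` and the bits
coded by the other pairs on stack `4`. -/
def scanProg : StackProg :=
  loop 0 (test 0
    (seq (pop 0) (test 0 (seq (pop 0) (push 3 true)) (seq (pop 0) (push 4 true)) skip))
    (seq (pop 0) (test 0 (seq (pop 0) (push 4 false)) (seq (pop 0) (push 2 true)) skip)) skip)

theorem runs_scanProg (r z c w : List Bool) (i j : ℕ) :
    ∃ i' j', Runs scanProg (st [r, z, List.replicate i true, List.replicate j true, c, w])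
      (st [[], z, List.replicate i' true, List.replicate j' true, (pairBits r).reverse ++ c, w])
      (8 * r.length + 1) ∧
      (i' = 0 ↔ i = 0 ∧ hasNone r = false) ∧ (j' = 0 ↔ j = 0 ∧ hasBoth r = false) := by
  induction r using List.twoStepInduction generalizing i j c with
  | nil => exact ⟨i, j, runs_loop_nil rfl, by simp [hasNone], by simp [hasBoth]⟩
  | singleton p =>
    refine ⟨i, j, Runs.mono (T := 7) ?_ (by simp), by simp [hasNone], by simp [hasBoth]⟩
    have h0 : Runs (pop 0) (st [[p], z, List.replicate i true, List.replicate j true, c, w])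
        (st [[], z, List.replicate i true, List.replicate j true, c, w]) 1 :=
      runs_pop.of_eq (by rw [update_st (by simp)]; rfl) le_rfl
    cases p
    · exact Runs.mono (Runs.loop_cons rfl (Runs.test_false rfl (h0.seq (Runs.test_nil rfl runs_skip)))
        (runs_loop_nil rfl)) (by simp)
    · exact Runs.mono (Runs.loop_cons rfl (Runs.test_true rfl (h0.seq (Runs.test_nil rfl runs_skip)))
        (runs_loop_nil rfl)) (by simp)
  | cons_cons p q r ih _ =>
    have h0 : Runs (pop 0) (st [p :: q :: r, z, List.replicate i true, List.replicate j true, c, w])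
        (st [q :: r, z, List.replicate i true, List.replicate j true, c, w]) 1 :=
      runs_pop.of_eq (by rw [update_st (by simp)]; rfl) le_rfl
    have h1 : Runs (pop 0) (st [q :: r, z, List.replicate i true, List.replicate j true, c, w])
        (st [r, z, List.replicate i true, List.replicate j true, c, w]) 1 :=
      runs_pop.of_eq (by rw [update_st (by simp)]; rfl) le_rfl
    cases p <;> cases q
    · obtain ⟨i', j', h, h', h''⟩ := ih c (i + 1) j
      refine ⟨i', j', (Runs.loop_cons rfl (Runs.test_false rfl (h0.seq (Runs.test_false rfl
        (h1.seq (runs_push.of_eq ?_ le_rfl))))) h).mono (by simp; omega),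
        by simp [h', hasNone], by simp [h'', hasBoth]⟩
      rw [update_st (by simp)]; rfl
    · obtain ⟨i', j', h, h', h''⟩ := ih (false :: c) i j
      refine ⟨i', j', ((Runs.loop_cons rfl (Runs.test_false rfl (h0.seq (Runs.test_true rfl
        (h1.seq (runs_push.of_eq ?_ le_rfl))))) h)).of_eq (by simp [pairBits]) (by simp; omega),
        by simp [h', hasNone], by simp [h'', hasBoth]⟩
      rw [update_st (by simp)]; rfl
    · obtain ⟨i', j', h, h', h''⟩ := ih (true :: c) i j
      refine ⟨i', j', ((Runs.loop_cons rfl (Runs.test_true rfl (h0.seq (Runs.test_false rfl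
        (h1.seq (runs_push.of_eq ?_ le_rfl))))) h)).of_eq (by simp [pairBits]) (by simp; omega),
        by simp [h', hasNone], by simp [h'', hasBoth]⟩
      rw [update_st (by simp)]; rfl
    · obtain ⟨i', j', h, h', h''⟩ := ih c i (j + 1)
      refine ⟨i', j', (Runs.loop_cons rfl (Runs.test_true rfl (h0.seq (Runs.test_true rfl
        (h1.seq (runs_push.of_eq ?_ le_rfl))))) h).mono (by simp; omega),
        by simp [h', hasNone], by simp [h'', hasBoth]⟩
      rw [update_st (by simp)]; rfl

/-- Remove the padding from the string on stack `4` and move it to stack `1`. -/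
def unpadProg : StackProg := loop 4 (test 4 (seq (pop 4) (move 4 1)) (pop 4) skip)

theorem runs_unpadProg (u w : List Bool) :
    Runs unpadProg (st [w, [], [], [], u, []])
      (st [w, ((u.dropWhile (!·)).tail).reverse, [], [], [], []]) (5 * u.length + 6) := by
  induction u with
  | nil => exact Runs.mono (runs_loop_nil rfl) (by simp)
  | cons b u ih =>
    have h0 : Runs (pop 4) (st [w, [], [], [], b :: u, []]) (st [w, [], [], [], u, []]) 1 :=
      runs_pop.of_eq (by rw [update_st (by simp)]; rfl) le_rfl
    cases b
    · exact Runs.mono (Runs.loop_cons rfl (Runs.test_false rfl h0) ih) (by simp; omega)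
    · have h1 : Runs (move 4 1) (st [w, [], [], [], u, []])
          (st [w, u.reverse, [], [], [], []]) (5 * u.length + 1) := by
        refine (runs_move (by norm_num)).of_eq ?_ le_rfl
        rw [update_st (by simp), update_st (by simp)]
        simp [st]
      exact (Runs.loop_cons rfl (Runs.test_true rfl (h0.seq h1)) (runs_loop_nil rfl)).of_eq
        (by simp) (by simp; omega)

/-- The score when the known part may contain a certificate, checked by the program `p`. -/
def certProg (p : StackProg) : StackProg :=
  seq scanProg (test 3 (out (digits 7)) skip (test 2 (out (digits 3)) skip
    (seq (clear 1) (seq (move 5 0) (seq unpadProg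
      (seq p (test 0 (out (digits 5)) (out (digits 3)) skip)))))))

theorem outputs_certProg {p : StackProg} {V : List Bool → Bool} {w : List Bool} {T : ℕ}
    (r : List Bool) (z : Bool) (hp : p.Answers [w, unpad (pairBits r)] T
      (V (unpad (pairBits r)))) :
    Outputs (certProg p) (st [r, [z], [], [], [], w.reverse])
      (20 * r.length + 7 * w.length + 3 * T + 50) (digits (certScore V r)) := by
  obtain ⟨i, j, hs, hi, hj⟩ := runs_scanProg r [z] [] w.reverse 0 0
  simp only [true_and] at hi hj
  unfold certScore
  cases hb : hasBoth r with
  | true =>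
    obtain ⟨j, rfl⟩ := Nat.exists_eq_succ_of_ne_zero (n := j) (by simp [hj, hb])
    exact Outputs.mono (hs.seq_outputs (Outputs.test_true rfl (outputs_out (T := 0) (by simp [st]))))
      (by simp [digits]; try omega)
  | false =>
    obtain rfl := hj.2 hb
    cases hn : hasNone r with
    | true =>
      obtain ⟨i, rfl⟩ := Nat.exists_eq_succ_of_ne_zero (n := i) (by simp [hi, hn])
      exact Outputs.mono (hs.seq_outputs (Outputs.test_nil rfl (Outputs.test_true rfl
        (outputs_out (T := 0) (by simp [st]))))) (by simp [digits]; try omega)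
    | false =>
      obtain rfl := hi.2 hn
      obtain ⟨σ', hr, hσ'⟩ := hp.runs
      obtain ⟨l, hl⟩ : ∃ l, σ' 0 = V (unpad (pairBits r)) :: l := by
        cases h : σ' 0 with
        | nil => simp [h] at hσ'
        | cons b l => simp [h] at hσ'; exact ⟨l, by rw [hσ']⟩
      -- The verifier may leave bits below its answer, and `out` has to clear them.
      have hlen : (σ' 0).length ≤ w.length + T := hr.length_le 0
      have h1 : Runs (clear 1) (st [[], [z], [], [], (pairBits r).reverse ++ [], w.reverse])
          (st [[], [], [], [], (pairBits r).reverse, w.reverse]) 3 :=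
        runs_clear.of_eq (by rw [update_st (by simp)]; simp) (by simp [st])
      have h2 : Runs (move 5 0) (st [[], [], [], [], (pairBits r).reverse, w.reverse])
          (st [w, [], [], [], (pairBits r).reverse, []]) (5 * w.length + 1) :=
        (runs_move (by norm_num)).of_eq
          (by rw [update_st (by simp), update_st (by simp)]; simp [st]) (by simp [st])
      have h3 := runs_unpadProg (pairBits r).reverse w
      -- The scratch stacks are empty again, so the store is exactly the one on which the verifier
      -- is started.
      have he : st [w, (((pairBits r).reverse.dropWhile (!·)).tail).reverse, [], [], [], []] =
          fun j => [w, unpad (pairBits r)].getD j [] := by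
        funext j
        match j with
        | 0 | 1 | 2 | 3 | 4 | 5 | _ + 6 => simp [st, unpad]
      rw [he] at h3
      have hu := pairBits_length_le r
      have h4 : Outputs (test 0 (out (digits 5)) (out (digits 3)) skip) σ'
          (2 * (w.length + T) + 12)
          (digits (if V (unpad (pairBits r)) = true then 5 else 3)) := by
        cases hV : V (unpad (pairBits r))
        · exact Outputs.mono (Outputs.test_false (hV ▸ hl) (outputs_out hlen)) (by simp [digits])
        · exact Outputs.mono (Outputs.test_true (hV ▸ hl) (outputs_out hlen)) (by simp [digits])
      refine (hs.seq_outputs (Outputs.test_nil rfl (Outputs.test_nil rfl (h1.seq_outputs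
        (h2.seq_outputs (h3.seq_outputs (hr.seq_outputs h4))))))).mono ?_
      simp
      omega

/-- The score `8`, `7`, `hi` or `lo`, depending on whether stack `0` contains `1` and on the
self-reported bit. -/
def lieProg (hi lo : ℕ) : StackProg :=
  seq anyProg (test 2 (test 1 (out (digits 8)) (out (digits 7)) skip) skip
    (test 1 (out (digits hi)) (out (digits lo)) skip))

theorem outputs_lieProg (hi lo : ℕ) (r w : List Bool) (z : Bool) :
    Outputs (lieProg hi lo) (st [r, [z], [], [], [], w]) (5 * r.length + 20)
      (digits (if r.any id then (if z then 8 else 7) else (if z then hi else lo))) := by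
  obtain ⟨i, hs, hi⟩ := runs_anyProg r [z] [] [] w 0
  simp only [true_and] at hi
  cases ha : r.any id with
  | true =>
    obtain ⟨i, rfl⟩ := Nat.exists_eq_succ_of_ne_zero (n := i) (by simp [hi, ha])
    cases z
    · exact Outputs.mono (hs.seq_outputs (Outputs.test_true rfl (Outputs.test_false rfl
        (outputs_out (T := 0) (by simp [st]))))) (by simp [digits])
    · exact Outputs.mono (hs.seq_outputs (Outputs.test_true rfl (Outputs.test_true rfl
        (outputs_out (T := 0) (by simp [st]))))) (by simp [digits])
  | false =>
    obtain rfl := hi.2 ha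
    cases z
    · exact Outputs.mono (hs.seq_outputs (Outputs.test_nil rfl (Outputs.test_false rfl
        (outputs_out (T := 0) (by simp [st]))))) (by simp [digits])
    · exact Outputs.mono (hs.seq_outputs (Outputs.test_nil rfl (Outputs.test_true rfl
        (outputs_out (T := 0) (by simp [st]))))) (by simp [digits])

/-- The score of a type, with the input of the verifier `p` reversed on stack `5`. -/
def scoreProg (p : StackProg) : StackProg :=
  test 0
    (seq (pop 0) (test 0 (out (digits 8))
      (seq (pop 0) (test 0 (seq (pop 0) (certProg p)) (out (digits 3)) skip)) skip))
    (seq (pop 0) (test 0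
      (seq (pop 0) (test 0 (seq (pop 0) (lieProg 6 2)) (seq (pop 0) (lieProg 4 1)) skip))
      (out (digits 0)) skip)) skip

theorem outputs_scoreProg {p : StackProg} {V : List Bool → Bool} {w : List Bool} {T : ℕ}
    (a b g : Bool) (r : List Bool) (z : Bool)
    (hp : p.Answers [w, unpad (pairBits r)] T (V (unpad (pairBits r)))) :
    Outputs (scoreProg p) (st [a :: b :: g :: r, [z], [], [], [], w.reverse])
      (20 * r.length + 7 * w.length + 3 * T + 70)
      (digits (listScore V (a :: b :: g :: r) z)) := by
  have hpop (y : Bool) (x : List Bool) : Runs (pop 0) (st [y :: x, [z], [], [], [], w.reverse])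
      (st [x, [z], [], [], [], w.reverse]) 1 :=
    runs_pop.of_eq (by rw [update_st (by simp)]; rfl) le_rfl
  have hout (v : ℕ) (x : List Bool) : Outputs (out (digits v))
      (st [x, [z], [], [], [], w.reverse]) (2 * x.length + 11) (digits v) :=
    outputs_out (T := x.length) (by simp [st])
  cases a <;> cases b
  · exact Outputs.mono (Outputs.test_false rfl ((hpop _ _).seq_outputs
      (Outputs.test_false rfl (hout _ _)))) (by simp; omega)
  · cases g
    · exact Outputs.mono (Outputs.test_false rfl ((hpop _ _).seq_outputs
        (Outputs.test_true rfl ((hpop _ _).seq_outputs (Outputs.test_false rfl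
          ((hpop _ _).seq_outputs (outputs_lieProg 4 1 r _ z))))))) (by omega)
    · exact Outputs.mono (Outputs.test_false rfl ((hpop _ _).seq_outputs
        (Outputs.test_true rfl ((hpop _ _).seq_outputs (Outputs.test_true rfl
          ((hpop _ _).seq_outputs (outputs_lieProg 6 2 r _ z))))))) (by omega)
  · cases g
    · exact Outputs.mono (Outputs.test_true rfl ((hpop _ _).seq_outputs
        (Outputs.test_false rfl ((hpop _ _).seq_outputs (Outputs.test_false rfl
          (hout _ _)))))) (by simp; omega)
    · exact Outputs.mono (Outputs.test_true rfl ((hpop _ _).seq_outputs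
        (Outputs.test_false rfl ((hpop _ _).seq_outputs (Outputs.test_true rfl
          ((hpop _ _).seq_outputs (outputs_certProg r z hp))))))) (by omega)
  · exact Outputs.mono (Outputs.test_true rfl ((hpop _ _).seq_outputs
      (Outputs.test_true rfl (hout _ _)))) (by simp; omega)

/-- Push the bits of a string on stack `5`, then run `p`. -/
def withWord (p : StackProg) : List Bool → StackProg
  | [] => p
  | b :: w => seq (push 5 b) (withWord p w)

/-- Pushing `w` from its first bit on leaves it reversed on stack 5; the final move to stack 0
restores the order. -/
theorem outputs_withWord {p : StackProg} (x z : List Bool) {T : ℕ} {l : List Bool} (w : List Bool) :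
    ∀ w₀, Outputs p (st [x, z, [], [], [], w.reverse ++ w₀]) T l →
      Outputs (withWord p w) (st [x, z, [], [], [], w₀]) (2 * w.length + T) l := by
  induction w with
  | nil => intro w₀ h; simpa [withWord] using h
  | cons b w ih =>
    intro w₀ h
    refine Outputs.mono ((runs_push.of_eq ?_ le_rfl).seq_outputs
      (ih (b :: w₀) (by simpa using h))) (by simp; omega)
    rw [update_st (by simp)]; rfl

/-- The program of an instance computes the score. -/
theorem iterate_withWord {p : StackProg} {V : List Bool → Bool} {w : List Bool} {T T' : ℕ}
    (a b g : Bool) (r : List Bool) (z : Bool)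
    (hp : p.Answers [w, unpad (pairBits r)] T (V (unpad (pairBits r))))
    (hT : 20 * r.length + 9 * w.length + 3 * T + 70 ≤ T') :
    (step^[T'] ((withWord (scoreProg p) w).start [a :: b :: g :: r, [z]])).2 0 =
      digits (listScore V (a :: b :: g :: r) z) := by
  obtain ⟨σ', h, h'⟩ := outputs_withWord (a :: b :: g :: r) [z] w []
    (by simpa using outputs_scoreProg a b g r z hp)
  have he : st [a :: b :: g :: r, [z], [], [], [], []] =
      fun j => [a :: b :: g :: r, [z]].getD j [] := by
    funext j
    match j with
    | 0 | 1 | 2 | 3 | 4 | 5 | _ + 6 => simp [st]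
  rw [he] at h
  rw [h.iterate_start (by omega)]
  exact h'

end StackProg

open Finset AuditGame

/-! ### Counting types by score -/

/-- The types with `m + 3` known features and one self-reported feature. -/
abbrev Report (m : ℕ) : Type := (Fin (m + 3) → Bool) × (Fin 1 → Bool)

/-- The score of a type. -/
def reportScore (V : List Bool → Bool) {m : ℕ} (t : Report m) : ℕ :=
  listScore V (List.ofFn t.1) (t.2 0)

theorem sum_ofFn_succ {n : ℕ} (F : List Bool → ℕ) :
    ∑ x : Fin (n + 1) → Bool, F (List.ofFn x) =
      (∑ x : Fin n → Bool, F (true :: List.ofFn x)) + ∑ x : Fin n → Bool, F (false :: List.ofFn x) := by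
  rw [← (Fin.consEquiv fun _ => Bool).sum_comp, Fintype.sum_prod_type, Fintype.sum_bool]
  simp [Fin.consEquiv, List.ofFn_succ]

theorem any_ofFn_eq_false {m : ℕ} (r : Fin m → Bool) :
    (List.ofFn r).any id = false ↔ r = fun _ => false := by
  simp [List.any_eq_false, List.mem_ofFn, funext_iff]

/-- Exactly one string, the zero string, takes the value `B` instead of `A`. The additive form
avoids subtraction of natural numbers. -/
theorem sum_any_ofFn {m : ℕ} (A B : ℕ) :
    (∑ r : Fin m → Bool, if (List.ofFn r).any id = true then A else B) + A = 2 ^ m * A + B := by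
  have h : ∀ r : Fin m → Bool, (if (List.ofFn r).any id = true then A else B) +
      (if r = fun _ => false then A else 0) = A + if r = fun _ => false then B else 0 := by
    intro r
    by_cases hr : r = fun _ => false
    · rw [if_neg (by simp [(any_ofFn_eq_false r).2 hr]), if_pos hr, if_pos hr, add_comm]
    · rw [if_pos (by simpa using mt (any_ofFn_eq_false r).1 hr), if_neg hr, if_neg hr]
  have := Finset.sum_congr rfl fun r (_ : r ∈ Finset.univ) => h r
  rw [Finset.sum_add_distrib, Finset.sum_add_distrib] at this
  simpa using this

/-- The number of strings of length `m` for which `certScore` has a given value. -/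
def certCount (V : List Bool → Bool) (m v : ℕ) : ℕ :=
  #{r : Fin m → Bool | certScore V (List.ofFn r) = v}

theorem certScore_cases (V : List Bool → Bool) (r : List Bool) :
    certScore V r = 3 ∨ certScore V r = 5 ∨ certScore V r = 7 := by
  unfold certScore
  split_ifs <;> simp

theorem sum_certScore (V : List Bool → Bool) (m : ℕ) (F : ℕ → ℕ) :
    ∑ r : Fin m → Bool, F (certScore V (List.ofFn r)) =
      certCount V m 3 * F 3 + certCount V m 5 * F 5 + certCount V m 7 * F 7 := by
  have h (r : Fin m → Bool) : F (certScore V (List.ofFn r)) =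
      (if certScore V (List.ofFn r) = 3 then F 3 else 0) +
      (if certScore V (List.ofFn r) = 5 then F 5 else 0) +
      (if certScore V (List.ofFn r) = 7 then F 7 else 0) := by
    rcases certScore_cases V (List.ofFn r) with h | h | h <;> simp [h]
  rw [Finset.sum_congr rfl fun r _ => h r]
  simp [Finset.sum_add_distrib, ← Finset.sum_filter, certCount]

theorem certCount_add (V : List Bool → Bool) (m : ℕ) :
    certCount V m 3 + certCount V m 5 + certCount V m 7 = 2 ^ m := by
  simpa using (sum_certScore V m fun _ => 1).symm

/-- A weighted census by score: `F` stands for the indicator of `P`, and each value `F v` is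
multiplied by the number of types of score `v`. The term added on the left accounts for the
exceptional types with a zero tail, two for each self-report, which do not score 7 or 8. -/
theorem card_reportScore (V : List Bool → Bool) (m : ℕ) (P : ℕ → Prop) [DecidablePred P]
    (F : ℕ → ℕ) (hF : ∀ v, F v = if P v then 1 else 0) :
    #{t : Report m | P (reportScore V t)} + 2 * (F 8 + F 7) =
      2 ^ m * (6 * F 8 + 2 * F 7 + 2 * F 3 + 4 * F 0) +
      2 * (certCount V m 3 * F 3 + certCount V m 5 * F 5 + certCount V m 7 * F 7) +
      (F 4 + F 1 + F 6 + F 2) := by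
  have h1 : #{t : Report m | P (reportScore V t)} = ∑ x : Fin (m + 3) → Bool,
      (F (listScore V (List.ofFn x) true) + F (listScore V (List.ofFn x) false)) := by
    rw [Finset.card_filter, Fintype.sum_prod_type]
    refine Finset.sum_congr rfl fun x _ => ?_
    rw [← (Equiv.funUnique (Fin 1) Bool).symm.sum_comp, Fintype.sum_bool]
    rw [hF, hF]
    rfl
  have h2 := sum_any_ofFn (m := m) (F 8 + F 7) (F 6 + F 2)
  have h3 := sum_any_ofFn (m := m) (F 8 + F 7) (F 4 + F 1)
  have h4 (g : Bool) (hi lo : ℕ) (hg : ∀ r z, listScore V (false :: true :: g :: r) z =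
        if r.any id then (if z then 8 else 7) else (if z then hi else lo)) (r : Fin m → Bool) :
      F (listScore V (false :: true :: g :: List.ofFn r) true) +
        F (listScore V (false :: true :: g :: List.ofFn r) false) =
      if (List.ofFn r).any id = true then F 8 + F 7 else F hi + F lo := by
    rw [hg, hg]
    by_cases h : (List.ofFn r).any id = true
    · simp only [if_pos h, if_true, Bool.false_eq_true, if_false]
    · simp only [if_neg h, if_true, Bool.false_eq_true, if_false]
  rw [h1, sum_ofFn_succ fun l => F (listScore V l true) + F (listScore V l false),
    sum_ofFn_succ fun l => F (listScore V (true :: l) true) + F (listScore V (true :: l) false),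
    sum_ofFn_succ fun l => F (listScore V (false :: l) true) + F (listScore V (false :: l) false),
    sum_ofFn_succ fun l => F (listScore V (true :: true :: l) true) +
      F (listScore V (true :: true :: l) false),
    sum_ofFn_succ fun l => F (listScore V (true :: false :: l) true) +
      F (listScore V (true :: false :: l) false),
    sum_ofFn_succ fun l => F (listScore V (false :: true :: l) true) +
      F (listScore V (false :: true :: l) false),
    sum_ofFn_succ fun l => F (listScore V (false :: false :: l) true) +
      F (listScore V (false :: false :: l) false),
    Finset.sum_congr rfl fun r _ => h4 true 6 2 (fun _ _ => by simp [listScore]) r,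
    Finset.sum_congr rfl fun r _ => h4 false 4 1 (fun _ _ => by simp [listScore]) r]
  simp only [listScore, Finset.sum_add_distrib, sum_certScore]
  simp only [Finset.sum_const, Finset.card_univ, Fintype.card_pi, Fintype.card_bool,
    Finset.prod_const, Fintype.card_fin, smul_eq_mul]
  linarith

/-! ### Comparison of the gains -/

/-- The case without valid certificates. The fourth-power identity `(v - u) * cubicMean v u = v⁴ -
u⁴` turns consecutive differences into second differences of `x⁴`, namely `12x² + 2`; one at `12K -
1` is set against one at `h + 1`. -/
theorem gain_first_ge {K h : ℝ} (hK : 4 ≤ K) (h0 : 0 ≤ h) (hh : h ≤ 10 * K - 4) :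
    cubicMean (12 * K - 1) (12 * K - 2) - cubicMean (h + 1) h + 32 * K ^ 2 ≤
      cubicMean (12 * K) (12 * K - 1) - cubicMean (h + 2) (h + 1) := by
  have e : cubicMean (12 * K) (12 * K - 1) - cubicMean (h + 2) (h + 1) -
      (cubicMean (12 * K - 1) (12 * K - 2) - cubicMean (h + 1) h) =
      12 * (12 * K - 1) ^ 2 - 12 * (h + 1) ^ 2 := by
    unfold cubicMean; ring
  have : (h + 1) ^ 2 ≤ (10 * K - 3) ^ 2 := by gcongr; linarith
  nlinarith

/-- Here `s` is the number of strings that code a valid certificate, each giving two types. Already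
for `s = 1` there are three second differences near `8K` against a single one at `12K - 1`, and
`3·64 > 144`. -/
theorem gain_second_ge {K h s : ℝ} (hK : 4 ≤ K) (hs : 1 ≤ s) (hh : 8 * K - 4 ≤ h) :
    cubicMean (12 * K) (12 * K - 1) - cubicMean (h + 2 + 2 * s) (h + 1 + 2 * s) + 32 * K ^ 2 ≤
      cubicMean (12 * K - 1) (12 * K - 2) - cubicMean (h + 1) h := by
  have h1 : cubicMean (h + 4) (h + 3) ≤ cubicMean (h + 2 + 2 * s) (h + 1 + 2 * s) :=
    cubicMean_mono (by linarith) (by linarith) (by linarith) (by linarith)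
  have e : cubicMean (h + 4) (h + 3) - cubicMean (h + 1) h - (cubicMean (12 * K) (12 * K - 1) -
      cubicMean (12 * K - 1) (12 * K - 2)) =
      12 * ((h + 1) ^ 2 + (h + 2) ^ 2 + (h + 3) ^ 2) + 4 - 12 * (12 * K - 1) ^ 2 := by
    unfold cubicMean; ring
  have h2 : (8 * K - 3) ^ 2 ≤ (h + 1) ^ 2 := by gcongr <;> linarith
  have h3 : (8 * K - 2) ^ 2 ≤ (h + 2) ^ 2 := by gcongr <;> linarith
  have h4 : (8 * K - 1) ^ 2 ≤ (h + 3) ^ 2 := by gcongr <;> linarith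
  nlinarith

/-- The lies from 7 to 8 happen at ranks at most `10K`, so a crude bound of order `K³` suffices:
`1960 K³` against about `(4·12³ - 4·10³) K³ = 2912 K³`. -/
theorem gain_generic_le {K h s : ℝ} (hK : 4 ≤ K) (h0 : 0 ≤ h) (hs : 0 ≤ s)
    (hh : h + 2 * s ≤ 10 * K - 4) :
    cubicMean h (6 * K - 2) - cubicMean (6 * K - 2) 0 + 32 * K ^ 2 ≤
      cubicMean (12 * K) (12 * K - 1) - cubicMean (h + 2 + 2 * s) (h + 1 + 2 * s) := by
  have h1 : cubicMean (12 * K - 1) (12 * K - 1) ≤ cubicMean (12 * K) (12 * K - 1) :=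
    cubicMean_mono (by linarith) le_rfl (by linarith) (by linarith)
  have h2 : cubicMean (h + 2 + 2 * s) (h + 1 + 2 * s) ≤ cubicMean (10 * K) (10 * K) :=
    cubicMean_mono (by linarith) (by linarith) (by linarith) (by linarith)
  have h3 : cubicMean h (6 * K - 2) - cubicMean (6 * K - 2) 0 ≤ 1960 * K ^ 3 := by
    have e : cubicMean h (6 * K - 2) - cubicMean (6 * K - 2) 0 =
        h ^ 3 + h ^ 2 * (6 * K - 2) + h * (6 * K - 2) ^ 2 := by unfold cubicMean; ring
    have e' : 1960 * K ^ 3 = (10 * K) ^ 3 + (10 * K) ^ 2 * (6 * K) + (10 * K) * (6 * K) ^ 2 := by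
      ring
    have i1 : h ≤ 10 * K := by linarith
    have i2 : 6 * K - 2 ≤ 6 * K := by linarith
    have i3 : 0 ≤ 6 * K - 2 := by linarith
    rw [e, e']
    gcongr
  have e1 : cubicMean (12 * K - 1) (12 * K - 1) = 4 * (12 * K - 1) ^ 3 := by
    unfold cubicMean; ring
  have e2 : cubicMean (10 * K) (10 * K) = 4000 * K ^ 3 := by unfold cubicMean; ring
  have h4 : K ^ 2 * 4 ≤ K ^ 3 := by
    rw [pow_succ K 2]; gcongr
  nlinarith

open Finset AuditGame

/-! ### The unaudited gains -/

/-- The chance of an agent who reports a type of score `L`. -/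
noncomputable def levelChance (V : List Bool → Bool) (m L : ℕ) : ℝ :=
  1 - cubicMean #{t : Report m | L ≤ reportScore V t} #{t : Report m | L < reportScore V t} /
    (4 * (Fintype.card (Report m) : ℝ) ^ 3)

theorem card_report (m : ℕ) : Fintype.card (Report m) = 16 * 2 ^ m := by
  simp [Report, pow_add]
  ring

theorem levelChance_mono (V : List Bool → Bool) (m : ℕ) : Monotone (levelChance V m) := by
  intro L L' h
  have h1 : (#{t : Report m | L' ≤ reportScore V t} : ℝ) ≤ #{t : Report m | L ≤ reportScore V t} := by
    exact_mod_cast Finset.card_le_card fun t => by simpa using h.trans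
  have h2 : (#{t : Report m | L' < reportScore V t} : ℝ) ≤ #{t : Report m | L < reportScore V t} := by
    exact_mod_cast Finset.card_le_card fun t => by simpa using h.trans_lt
  have := cubicMean_mono (by positivity) h2 (by positivity) h1
  unfold levelChance
  gcongr

section Gains

variable (V : List Bool → Bool) (m : ℕ)

/-- The gap between the gain from the best lie and that from the other lies. -/
noncomputable def gainGap (m : ℕ) : ℝ := 1 / (2 ^ 9 * 2 ^ m)

theorem card_le_reportScore :
    (#{t : Report m | 1 ≤ reportScore V t} : ℝ) = 12 * 2 ^ m ∧
    (#{t : Report m | 1 < reportScore V t} : ℝ) = 12 * 2 ^ m - 1 ∧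
    (#{t : Report m | 2 ≤ reportScore V t} : ℝ) = 12 * 2 ^ m - 1 ∧
    (#{t : Report m | 2 < reportScore V t} : ℝ) = 12 * 2 ^ m - 2 ∧
    (#{t : Report m | 8 ≤ reportScore V t} : ℝ) = 6 * 2 ^ m - 2 ∧
    (#{t : Report m | 8 < reportScore V t} : ℝ) = 0 ∧
    (#{t : Report m | 7 < reportScore V t} : ℝ) = 6 * 2 ^ m - 2 ∧
    (#{t : Report m | 7 ≤ reportScore V t} : ℝ) = 8 * 2 ^ m - 4 + 2 * certCount V m 7 ∧
    (#{t : Report m | 6 < reportScore V t} : ℝ) = 8 * 2 ^ m - 4 + 2 * certCount V m 7 ∧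
    (#{t : Report m | 6 ≤ reportScore V t} : ℝ) = 8 * 2 ^ m - 4 + 2 * certCount V m 7 + 1 ∧
    (#{t : Report m | 4 < reportScore V t} : ℝ) =
      8 * 2 ^ m - 4 + 2 * certCount V m 7 + 1 + 2 * certCount V m 5 ∧
    (#{t : Report m | 4 ≤ reportScore V t} : ℝ) =
      8 * 2 ^ m - 4 + 2 * certCount V m 7 + 2 + 2 * certCount V m 5 := by
  have hs : (certCount V m 3 + certCount V m 5 + certCount V m 7 : ℝ) = 2 ^ m := by
    exact_mod_cast certCount_add V m
  have h (P : ℕ → Prop) [DecidablePred P] := congrArg (Nat.cast : ℕ → ℝ)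
    (card_reportScore V m P (fun v => if P v then 1 else 0) fun _ => rfl)
  refine ⟨?_, ?_, ?_, ?_, ?_, ?_, ?_, ?_, ?_, ?_, ?_, ?_⟩
  · have := h (1 ≤ ·); norm_num at this; linarith
  · have := h (1 < ·); norm_num at this; linarith
  · have := h (2 ≤ ·); norm_num at this; linarith
  · have := h (2 < ·); norm_num at this; linarith
  · have := h (8 ≤ ·); norm_num at this; linarith
  · have := h (8 < ·); norm_num at this; simpa using this
  · have := h (7 < ·); norm_num at this; linarith
  · have := h (7 ≤ ·); norm_num at this; linarith
  · have := h (6 < ·); norm_num at this; linarith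
  · have := h (6 ≤ ·); norm_num at this; linarith
  · have := h (4 < ·); norm_num at this; linarith
  · have := h (4 ≤ ·); norm_num at this; linarith

variable {m} (hm : 2 ≤ m)
include hm

/-- The margin `32K²` of the comparison lemmas, divided by `4N³ = 2¹⁴K³`, is `gainGap m`. -/
theorem gains :
    (levelChance V m 8 - levelChance V m 7 ≤
      levelChance V m 4 - levelChance V m 1 - gainGap m) ∧
    (certCount V m 5 = 0 → levelChance V m 6 - levelChance V m 2 ≤
      levelChance V m 4 - levelChance V m 1 - gainGap m) ∧
    (certCount V m 5 ≠ 0 → levelChance V m 4 - levelChance V m 1 ≤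
      levelChance V m 6 - levelChance V m 2 - gainGap m) := by
  obtain ⟨c1, c1', c2, c2', c8, c8', c7', c7, c6', c6, c4', c4⟩ := card_le_reportScore V m
  have hK : (4 : ℝ) ≤ 2 ^ m := by
    calc (4 : ℝ) = 2 ^ 2 := by norm_num
      _ ≤ 2 ^ m := by gcongr; norm_num
  have hs : (certCount V m 3 + certCount V m 5 + certCount V m 7 : ℝ) = 2 ^ m := by
    exact_mod_cast certCount_add V m
  have h3 : (0 : ℝ) ≤ certCount V m 3 := by positivity
  have h5 : (0 : ℝ) ≤ certCount V m 5 := by positivity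
  have h7 : (0 : ℝ) ≤ certCount V m 7 := by positivity
  have hN : (4 * (Fintype.card (Report m) : ℝ) ^ 3) = 2 ^ 14 * (2 ^ m) ^ 3 := by
    rw [card_report]; push_cast; ring
  have hgap : gainGap m = 32 * (2 ^ m) ^ 2 / (2 ^ 14 * (2 ^ m) ^ 3) := by
    unfold gainGap; field_simp; norm_num
  unfold levelChance
  rw [c1, c1', c2, c2', c8, c8', c7', c7, c6', c6, c4', c4, hN, hgap]
  generalize (2 : ℝ) ^ m = K at *
  have hD : (0 : ℝ) < 2 ^ 14 * K ^ 3 := by positivity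
  have key {x y u v : ℝ} (h : u - v + 32 * K ^ 2 ≤ x - y) :
      1 - v / (2 ^ 14 * K ^ 3) - (1 - u / (2 ^ 14 * K ^ 3)) ≤
        1 - y / (2 ^ 14 * K ^ 3) - (1 - x / (2 ^ 14 * K ^ 3)) -
          32 * K ^ 2 / (2 ^ 14 * K ^ 3) := by
    have := div_le_div_of_nonneg_right h hD.le
    rw [add_div, sub_div, sub_div] at this
    linarith
  refine ⟨key (gain_generic_le hK (by linarith) h5 (by linarith)), fun h => key ?_,
    fun h => key (gain_second_ge hK ?_ (by linarith))⟩
  · rw [h, Nat.cast_zero, mul_zero, add_zero, add_zero]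
    exact gain_first_ge hK (by linarith) (by linarith)
  · exact_mod_cast Nat.one_le_iff_ne_zero.2 h

end Gains

/-- The types with an exceptional gain: `g` distinguishes two of them, `z` is the self-report. -/
def lieType (m : ℕ) (g z : Bool) : Report m :=
  (Fin.cons false (Fin.cons true (Fin.cons g fun _ => false)), fun _ => z)

theorem reportScore_lieType (V : List Bool → Bool) (m : ℕ) (g z : Bool) :
    reportScore V (lieType m g z) = if g then (if z then 6 else 2) else (if z then 4 else 1) := by
  have h : (List.ofFn fun _ : Fin m => false).any id = false := (any_ofFn_eq_false _).2 rfl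
  simp only [reportScore, lieType, List.ofFn_succ, Fin.cons_zero, Fin.cons_succ, listScore, h]
  simp

/-- The self-report affects the score only for known parts 01…, so every profitable lie occurs
there: the tail is either non-zero, with scores 7 and 8, or zero, with one of the two exceptional
types. -/
theorem reportScore_cases (V : List Bool → Bool) {m : ℕ} {a b : Report m} (h : b.1 = a.1) :
    reportScore V b ≤ reportScore V a ∨ (reportScore V a = 7 ∧ reportScore V b = 8) ∨
      ∃ g, a = lieType m g false ∧ b = lieType m g true := by
  obtain ⟨x, z⟩ := a
  obtain ⟨x', z'⟩ := b
  obtain rfl : x' = x := h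
  obtain ⟨z, rfl⟩ : ∃ y, z = fun _ => y := ⟨z 0, by funext i; rw [Subsingleton.elim i 0]⟩
  obtain ⟨z', rfl⟩ : ∃ y, z' = fun _ => y := ⟨z' 0, by funext i; rw [Subsingleton.elim i 0]⟩
  obtain ⟨p, x, rfl⟩ : ∃ p y, x' = Fin.cons p y := ⟨_, _, (Fin.cons_self_tail x').symm⟩
  obtain ⟨q, x, rfl⟩ : ∃ p y, x = Fin.cons p y := ⟨_, _, (Fin.cons_self_tail x).symm⟩
  obtain ⟨g, r, rfl⟩ : ∃ p y, x = Fin.cons p y := ⟨_, _, (Fin.cons_self_tail x).symm⟩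
  simp only [reportScore, List.ofFn_succ, Fin.cons_zero, Fin.cons_succ]
  cases p
  · cases q
    · exact .inl (by simp [listScore])
    · cases hr : (List.ofFn r).any id
      · obtain rfl := (any_ofFn_eq_false r).1 hr
        cases z
        · cases z'
          · exact .inl le_rfl
          · exact .inr (.inr ⟨g, rfl, rfl⟩)
        · refine .inl ?_
          simp only [listScore, hr]
          cases g <;> cases z' <;> simp
      · simp only [listScore, hr]
        cases z <;> cases z' <;> simp
  · cases q
    · cases g <;> exact .inl (by simp [listScore])
    · exact .inl (by simp [listScore])

theorem lieType_injective {m : ℕ} {g g' z z' : Bool} (h : lieType m g z = lieType m g' z') :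
    g = g' ∧ z = z' := by
  have h1 := congrFun (congrArg Prod.fst h) 2
  have h2 := congrFun (congrArg Prod.snd h) 0
  exact ⟨h1, h2⟩

/-- The lie of the type `lieType m g false` is dominant, where `g` tells whether there is a valid
certificate. -/
theorem isDominantLie {V : List Bool → Bool} {m : ℕ} (hm : 2 ≤ m)
    {G : AuditGame (Fin (m + 3) → Bool) (Fin 1 → Bool)} (hD : G.D = PMF.uniformOfFintype _)
    (hf : ∀ t, G.f t = reportScore V t) (hk : G.k = 3) (hB : G.B = 1 / (2 ^ 10 * 2 ^ m))
    (hc : G.c = 1) {g : Bool} (hg : g = true ↔ certCount V m 5 ≠ 0) :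
    G.IsDominantLie 4 (fun t => levelChance V m (reportScore V t))
      (lieType m g false) (lieType m g true) where
  uniform := hD
  budget_pos := by rw [hB]; positivity
  budget_le := by
    rw [hB, div_le_one (by positivity)]
    exact one_le_mul_of_one_le_of_one_le (by norm_num) (one_le_pow₀ (by norm_num))
  fine_pos := by rw [hc]; exact one_pos
  chance_eq i t := by
    rw [chance_eq_cubicMean hD hk, levelChance]
    simp [hf]
  same_known := rfl
  ne h := by simpa using (lieType_injective h).2
  gap a b hab hne := by
    obtain ⟨h1, h2, h3⟩ := gains V hm
    -- With fine 1, the budget is chosen as half the gap.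
    have hgap : G.B * (1 + G.c) = gainGap m := by
      rw [hB, hc, gainGap]; field_simp; norm_num
    have h0 : 0 ≤ levelChance V m 8 - levelChance V m 7 :=
      sub_nonneg.2 (levelChance_mono V m (by norm_num))
    have hpos : 0 < gainGap m := by unfold gainGap; positivity
    have hmain : levelChance V m 8 - levelChance V m 7 ≤
        levelChance V m (reportScore V (lieType m g true)) -
          levelChance V m (reportScore V (lieType m g false)) - gainGap m := by
      rw [reportScore_lieType, reportScore_lieType]
      cases g
      · simpa using h1
      · have := h3 (hg.1 rfl)
        simp only [if_true, Bool.false_eq_true, if_false]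
        linarith
    rw [hgap]
    rcases reportScore_cases V hab with h | ⟨h, h'⟩ | ⟨g', rfl, rfl⟩
    · have := levelChance_mono V m h
      linarith
    · rw [h, h']
      exact hmain
    · have hgg : g' ≠ g := by
        rintro rfl
        simp at hne
      simp only [reportScore_lieType]
      cases g <;> cases g'
      · exact absurd rfl hgg
      · simpa using h2 (by simpa using hg)
      · simpa using h3 (hg.1 rfl)
      · exact absurd rfl hgg

open Finset AuditGame StackProg

/-! ### Monotonicity of the score -/

theorem hasBoth_mono {r r' : List Bool} (h : List.Forall₂ (· ≤ ·) r r') :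
    hasBoth r = true → hasBoth r' = true := by
  induction r using List.twoStepInduction generalizing r' with
  | nil => simp [hasBoth]
  | singleton p => simp [hasBoth]
  | cons_cons p q r ih _ =>
    obtain _ | ⟨hp, _ | ⟨hq, hr⟩⟩ := h
    have := ih hr
    simp only [hasBoth, Bool.or_eq_true, Bool.and_eq_true]
    rintro (⟨rfl, rfl⟩ | h)
    · exact .inl ⟨Bool.le_iff_imp.1 hp rfl, Bool.le_iff_imp.1 hq rfl⟩
    · exact .inr (this h)

/-- Distinct pairs among 10 and 01 are incomparable. Raising bits without creating a pair 11, from a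
string without pairs 00, therefore changes no complete pair, and the coded string stays the same. -/
theorem pairBits_eq_of_le {r r' : List Bool} (h : List.Forall₂ (· ≤ ·) r r')
    (h₁ : hasNone r = false) (h₂ : hasBoth r' = false) :
    hasNone r' = false ∧ pairBits r' = pairBits r := by
  induction r using List.twoStepInduction generalizing r' with
  | nil => cases h; exact ⟨rfl, rfl⟩
  | singleton p => obtain _ | ⟨hp, _ | _⟩ := h; exact ⟨rfl, rfl⟩
  | cons_cons p q r ih _ =>
    obtain _ | @⟨_, p', _, _, hp, _ | @⟨_, q', _, r', hq, hr⟩⟩ := h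
    simp only [hasNone, hasBoth, Bool.or_eq_false_iff, pairBits] at h₁ h₂ ⊢
    obtain ⟨i₁, i₂⟩ := ih hr h₁.2 h₂.2
    revert hp hq
    cases p <;> cases q <;> cases p' <;> cases q' <;> simp_all

theorem certScore_le (V : List Bool → Bool) (r : List Bool) : certScore V r ≤ 7 := by
  rcases certScore_cases V r with h | h | h <;> omega

theorem three_le_certScore (V : List Bool → Bool) (r : List Bool) : 3 ≤ certScore V r := by
  rcases certScore_cases V r with h | h | h <;> omega

theorem certScore_mono (V : List Bool → Bool) {r r' : List Bool}
    (h : List.Forall₂ (· ≤ ·) r r') : certScore V r ≤ certScore V r' := by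
  cases hb' : hasBoth r' with
  | true => rw [show certScore V r' = 7 by simp [certScore, hb']]; exact certScore_le V r
  | false =>
    have hb : hasBoth r = false := by
      by_contra hb
      simp [hasBoth_mono h (by simpa using hb)] at hb'
    cases hn : hasNone r with
    | true =>
      rw [show certScore V r = 3 by simp [certScore, hb, hn]]
      exact three_le_certScore V r'
    | false =>
      obtain ⟨hn', hp⟩ := pairBits_eq_of_le h hn hb'
      simp [certScore, hb, hb', hn, hn', hp]

theorem any_mono {r r' : List Bool} (h : List.Forall₂ (· ≤ ·) r r') :
    r.any id = true → r'.any id = true := by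
  induction h with
  | nil => simp
  | cons hp _ ih =>
    simp only [List.any_cons, id, Bool.or_eq_true]
    rintro (rfl | h)
    · exact .inl (Bool.le_iff_imp.1 hp rfl)
    · exact .inr (ih h)

theorem listScore_le (V : List Bool → Bool) (x : List Bool) (z : Bool) : listScore V x z ≤ 8 := by
  unfold listScore
  split
  · exact le_rfl
  · exact (certScore_le V _).trans (by norm_num)
  · norm_num
  · split_ifs <;> norm_num
  · norm_num
  · norm_num

theorem listScore_mono (V : List Bool → Bool) {a b g a' b' g' : Bool} {r r' : List Bool}
    {z z' : Bool} (ha : a ≤ a') (hb : b ≤ b') (hg : g ≤ g') (hr : List.Forall₂ (· ≤ ·) r r')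
    (hz : z ≤ z') :
    listScore V (a :: b :: g :: r) z ≤ listScore V (a' :: b' :: g' :: r') z' := by
  have h1 := certScore_mono V hr
  have h3 := three_le_certScore V r'
  have h4 := any_mono hr
  cases a'
  · obtain rfl : a = false := by revert ha; cases a <;> decide
    cases b
    · simp [listScore]
    · obtain rfl : b' = true := Bool.le_iff_imp.1 hb rfl
      simp only [listScore]
      cases hra : r.any id
      · cases hra' : r'.any id
        · revert hg hz
          cases g <;> cases g' <;> cases z <;> cases z' <;> decide
        · revert hg hz
          cases g <;> cases z <;> cases z' <;> simp
      · rw [h4 hra]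
        revert hz
        cases z <;> cases z' <;> simp
  · cases b'
    · obtain rfl : b = false := by revert hb; cases b <;> decide
      cases a
      · simp [listScore]
      · revert hg
        cases g <;> cases g' <;> simp [listScore, h1, h3]
    · exact (listScore_le V _ z).trans_eq (by simp [listScore])

theorem forall₂_ofFn {n : ℕ} {x y : Fin n → Bool} (h : x ≤ y) :
    List.Forall₂ (· ≤ ·) (List.ofFn x) (List.ofFn y) := by
  induction n with
  | zero => simp
  | succ n ih =>
    rw [List.ofFn_succ, List.ofFn_succ]
    exact .cons (h 0) (ih fun i => h i.succ)

theorem reportScore_mono (V : List Bool → Bool) (m : ℕ) :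
    Monotone (reportScore V : Report m → ℕ) := by
  rintro ⟨x, z⟩ ⟨x', z'⟩ ⟨hx, hz⟩
  simp only [reportScore, List.ofFn_succ]
  exact listScore_mono V (hx 0) (hx _) (hx _) (forall₂_ofFn fun i => hx _) (hz 0)

/-! ### Sure-truths -/

/-- Under the uniform distribution every type has positive probability, and with three resources the
chance is strictly increasing in the score. -/
theorem AuditGame.isSureTruth_iff {X Z : Type} [Fintype X] [Fintype Z] {G : AuditGame X Z}
    [Nonempty (X × Z)] (hD : G.D = PMF.uniformOfFintype _) (hk : G.k = 3) (i : Fin 4)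
    (b : X × Z) : G.IsSureTruth i b ↔ ∀ z, G.f b ≤ G.f (b.1, z) := by
  have hpos (t : X × Z) : G.D t ≠ 0 := by
    rw [hD]; exact (PMF.mem_support_iff _ _).1 (by simp)
  constructor
  · rintro ⟨-, h⟩ z
    have : Nonempty Z := ⟨z⟩
    obtain ⟨z₀, h₀⟩ := Finite.exists_min fun z => G.f (b.1, z)
    by_contra! hlt
    exact h ⟨z₀, ⟨hpos _, fun z _ => h₀ z⟩, chance_lt_chance hD hk i ((h₀ z).trans_lt hlt)⟩
  · refine fun h => ⟨hpos b, ?_⟩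
    rintro ⟨z, -, hlt⟩
    rcases (h z).lt_or_eq with h' | h'
    · exact lt_asymm hlt (chance_lt_chance hD hk i h')
    · exact hlt.ne (chance_congr hD hk i h').symm

/-- The program that identifies the sure-truths. -/
def truthProg : StackProg :=
  test 0 (push 0 true) (seq (pop 0) (test 0 (test 1 (push 0 false) (push 0 true) skip)
    (push 0 true) skip)) skip

theorem truthProg_answers (a b z : Bool) (x : List Bool) :
    truthProg.Answers [a :: b :: x, [z]] 10 (!(!a && b && z)) := by
  cases a
  · cases b
    · exact ⟨5, by norm_num, rfl, rfl⟩
    · cases z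
      · exact ⟨6, by norm_num, rfl, rfl⟩
      · exact ⟨6, by norm_num, rfl, rfl⟩
  · exact ⟨2, by norm_num, rfl, rfl⟩

/-- For known parts 01… self-report 1 scores strictly more whatever the remaining bits are;
elsewhere the self-report is irrelevant. So neither the tail nor the verifier has to be consulted.
-/
theorem listScore_le_iff (V : List Bool → Bool) (a b g z : Bool) (r : List Bool) :
    (∀ z', listScore V (a :: b :: g :: r) z ≤ listScore V (a :: b :: g :: r) z') ↔
      (!(!a && b && z)) = true := by
  rw [Bool.forall_bool]
  cases hr : r.any id <;> cases a <;> cases b <;> cases g <;> cases z <;> simp [listScore, hr]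

/-! ### Certificates -/

theorem pairs_facts (u : List Bool) :
    hasBoth (u.flatMap fun b => [b, !b]) = false ∧ hasNone (u.flatMap fun b => [b, !b]) = false ∧
      pairBits (u.flatMap fun b => [b, !b]) = u := by
  induction u with
  | nil => exact ⟨rfl, rfl, rfl⟩
  | cons b u ih => cases b <;> simp [hasBoth, hasNone, pairBits, ih]

/-- A certificate of length at most `l` is padded by `1` and zeros to length `l + 1`, and each bit
takes a pair. All lengths up to `l` are thus covered by strings of one length. -/
theorem certCount_ne_zero_iff (V : List Bool → Bool) (l : ℕ) :
    certCount V (2 * (l + 1)) 5 ≠ 0 ↔ ∃ c : List Bool, c.length ≤ l ∧ V c = true := by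
  unfold certCount
  rw [Finset.card_ne_zero]
  constructor
  · rintro ⟨r, hr⟩
    refine ⟨unpad (pairBits (List.ofFn r)), ?_, ?_⟩
    · have h1 := unpad_length_le (pairBits (List.ofFn r))
      have h2 := pairBits_length_le (List.ofFn r)
      rw [List.length_ofFn] at h2
      omega
    · rw [Finset.mem_filter_univ, certScore] at hr
      by_contra h
      rw [if_neg h] at hr
      split_ifs at hr <;> omega
  · rintro ⟨c, hc, hV⟩
    obtain ⟨u, hu⟩ : ∃ u, u = c ++ true :: List.replicate (l - c.length) false := ⟨_, rfl⟩
    obtain ⟨h1, h2, h3⟩ := pairs_facts u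
    have hlen : (u.flatMap fun b => [b, !b]).length = 2 * (l + 1) := by
      simp [hu, List.length_flatMap]
      omega
    generalize (u.flatMap fun b => [b, !b]) = r at *
    refine ⟨fun i => r[i.1]'(by rw [hlen]; exact i.2), ?_⟩
    have : (List.ofFn fun i : Fin (2 * (l + 1)) => r[i.1]'(by rw [hlen]; exact i.2)) = r := by
      apply List.ext_getElem
      · rw [List.length_ofFn, hlen]
      · intro i _ _
        rw [List.getElem_ofFn]
    rw [Finset.mem_filter_univ, this]
    simp [certScore, h1, h2, h3, hu, unpad_append, hV]

open Finset AuditGame StackProg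

/-! ### The reduction -/

/-- The instance for the input `w`, where `p` checks certificates. -/
def auditInstance (p : StackProg) (w : List Bool) (m clock : ℕ) : AuditInstance 4 where
  d := m + 3
  s := 1
  prog := withWord (scoreProg p) w
  clock := clock
  k := 3
  budget := (2 ^ (m + 10))⁻¹
  fine := 1
  reports := ![lieType m false true, lieType m true true, (fun _ => false, fun _ => false),
    (fun _ => false, fun _ => false)]

theorem ofDigits_digits {v : ℕ} (hv : v ≤ 8) :
    Nat.ofDigits 2 ((digits v).map Bool.toNat) = v := by
  interval_cases v <;> rfl

section Instance

variable {p : StackProg} {V : List Bool → Bool} {w : List Bool} {m clock T : ℕ}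
  (hp : ∀ r : List Bool, r.length = m →
    p.Answers [w, unpad (pairBits r)] T (V (unpad (pairBits r))))
  (hclock : 20 * m + 9 * w.length + 3 * T + 70 ≤ clock)
include hp hclock

theorem auditInstance_score (t : Report m) :
    (auditInstance p w m clock).score t = reportScore V t := by
  have h2 : List.ofFn t.2 = [t.2 0] := by simp
  have h1 : List.ofFn t.1 = t.1 0 :: t.1 1 :: t.1 2 :: List.ofFn fun i => t.1 i.succ.succ.succ := by
    simp only [List.ofFn_succ]; rfl
  have := iterate_withWord (T' := clock) (t.1 0) (t.1 1) (t.1 2)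
    (List.ofFn fun i => t.1 i.succ.succ.succ) (t.2 0) (hp _ (by simp)) (by simpa using hclock)
  rw [← h1, ← h2] at this
  exact (congrArg (fun l => Nat.ofDigits 2 (l.map Bool.toNat)) this).trans
    (ofDigits_digits (listScore_le _ _ _))

theorem auditInstance_admissible :
    (topKAuditProblem 4 truthProg 10).Admissible (auditInstance p w m clock) := by
  have hs := auditInstance_score hp hclock
  refine ⟨by norm_num [auditInstance], by norm_num [auditInstance], ?_, fun i t => ?_⟩
  · intro a b h
    exact ((hs a).trans_le (reportScore_mono V m h)).trans_eq (hs b).symm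
  · change Report m at t
    have h2 : List.ofFn t.2 = [t.2 0] := by simp
    have h1 : List.ofFn t.1 =
        t.1 0 :: t.1 1 :: t.1 2 :: List.ofFn fun i => t.1 i.succ.succ.succ := by
      simp only [List.ofFn_succ]; rfl
    refine ⟨!(!t.1 0 && t.1 1 && t.2 0), ?_, ?_⟩
    · have := truthProg_answers (t.1 0) (t.1 1) (t.2 0)
        (t.1 2 :: List.ofFn fun i => t.1 i.succ.succ.succ)
      rw [← h1, ← h2] at this
      exact this
    · have key := listScore_le_iff V (t.1 0) (t.1 1) (t.1 2) (t.2 0)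
        (List.ofFn fun i => t.1 i.succ.succ.succ)
      rw [← h1] at key
      have hle (z : Fin 1 → Bool) : (auditInstance p w m clock).game.f t ≤
          (auditInstance p w m clock).game.f (t.1, z) ↔
            listScore V (List.ofFn t.1) (t.2 0) ≤ listScore V (List.ofFn t.1) (z 0) := by
        rw [show (auditInstance p w m clock).game.f t = (reportScore V t : ℝ) from
            congrArg Nat.cast (hs t),
          show (auditInstance p w m clock).game.f (t.1, z) = (reportScore V (t.1, z) : ℝ) from
            congrArg Nat.cast (hs (t.1, z)), Nat.cast_le]
        rfl
      exact key.symm.trans (Iff.trans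
        ⟨fun h z => (hle z).2 (h (z 0)), fun h z => (hle fun _ => z).1 (h fun _ => z)⟩
        (isSureTruth_iff (G := (auditInstance p w m clock).game) rfl rfl i t).symm)

theorem auditInstance_isDominantLie (hm : 2 ≤ m) {g : Bool}
    (hg : g = true ↔ certCount V m 5 ≠ 0) :
    (auditInstance p w m clock).game.IsDominantLie 4
      (fun t => levelChance V m (reportScore V t)) (lieType m g false) (lieType m g true) := by
  refine isDominantLie hm rfl
    (fun t => congrArg Nat.cast (auditInstance_score hp hclock t)) rfl ?_ ?_ hg
  · simp only [AuditInstance.game, auditInstance]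
    push_cast
    rw [pow_add, mul_comm, one_div]
  · simp [AuditInstance.game, auditInstance]

/-- The audited agents reveal whether there is a valid certificate. -/
theorem auditInstance_isSolution (hm : 2 ≤ m) :
    (∃ y, (auditInstance p w m clock).IsAuditedSet y) ∧
      ∀ y, (auditInstance p w m clock).IsAuditedSet y →
        ((y.head? != some true) = true ↔ certCount V m 5 ≠ 0) := by
  classical
  obtain ⟨g, hg⟩ : ∃ g : Bool, g = true ↔ certCount V m 5 ≠ 0 :=
    ⟨decide (certCount V m 5 ≠ 0), by simp⟩
  have hd := auditInstance_isDominantLie hp hclock hm hg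
  refine ⟨⟨_, _, hd.sharePolicy_isOptimal, fun i => decide _, rfl, fun i => decide_eq_true_iff⟩, ?_⟩
  rintro y ⟨φ, hφ, v, rfl, hv⟩
  have hzero (g : Bool) : ((fun _ => false, fun _ => false) : Report m) ≠ lieType m g true := by
    intro h
    simpa [lieType] using congrFun (congrArg Prod.snd h) 0
  have hne {g g' : Bool} (h : g ≠ g') : lieType m g true ≠ lieType m g' true := fun h' =>
    h (lieType_injective h').1
  have h0 := hd.eq_budget_of_isOptimal hφ (A := (auditInstance p w m clock).reports)
    -- Agents 0 and 1 make the two exceptional reports, and the zero reports of agents 2 and 3 match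
    -- neither. So the dominant lie is reported by exactly one agent.
    (i := if g then 1 else 0) (by cases g <;> rfl) (fun j hj => by
      cases g <;> fin_cases j
      · exact absurd rfl hj
      · exact hne (by simp)
      · exact hzero _
      · exact hzero _
      · exact hne (by simp)
      · exact absurd rfl hj
      · exact hzero _
      · exact hzero _) 0
  have hv0 := hv 0
  rw [h0] at hv0
  rw [← hg]
  have hB := hd.budget_pos
  cases g
  · rw [if_pos (by simp)] at hv0
    simp [List.ofFn_succ, hv0.2 hB]
  · rw [if_neg (by simp)] at hv0
    have : v 0 = false := by simpa using hv0
    simp [List.ofFn_succ, this]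

end Instance

/-! ### The reduction takes polynomial time -/

theorem num_den_inv_two_pow (e : ℕ) :
    ((2 ^ e : ℚ≥0)⁻¹).num = 1 ∧ ((2 ^ e : ℚ≥0)⁻¹).den = 2 ^ e := by
  have h : ((2 ^ e : ℚ≥0)⁻¹ : ℚ≥0) = ((2 : ℚ≥0)⁻¹) ^ e := by rw [inv_pow]
  have h2 : ((2 : ℚ≥0)⁻¹).num = 1 ∧ ((2 : ℚ≥0)⁻¹).den = 2 := by decide +kernel
  rw [h, NNRat.num_pow, NNRat.den_pow, h2.1, h2.2, one_pow]
  exact ⟨rfl, rfl⟩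

theorem encodeNat_two_pow (e : ℕ) :
    Computability.encodeNat (2 ^ e) = List.replicate e false ++ [true] := by
  obtain ⟨q, hq, hq'⟩ : ∃ q : PosNum, (q : ℕ) = 2 ^ e ∧
      Computability.encodePosNum q = List.replicate e false ++ [true] := by
    induction e with
    | zero => exact ⟨1, rfl, rfl⟩
    | succ e ih =>
      obtain ⟨q, h, h'⟩ := ih
      refine ⟨q.bit0, ?_, by simp [Computability.encodePosNum, h', List.replicate_succ]⟩
      rw [PosNum.cast_bit0, h, pow_succ]; ring
  have : ((2 ^ e : ℕ) : Num) = Num.pos q := by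
    rw [← hq, ← Num.cast_pos, Num.of_to_nat]
  rw [Computability.encodeNat, this, Computability.encodeNum, hq']

theorem codeBits_replicate_append (n : ℕ) (b : Bool) (l : List Bool) :
    codeBits (List.replicate n b ++ l) = rep n [true, b] ++ codeBits l := by
  induction n with
  | zero => rfl
  | succ n ih => simpa [List.replicate_succ, codeBits, rep] using ih

theorem codeBits_replicate (n : ℕ) (b : Bool) :
    codeBits (List.replicate n b) = rep n [true, b] ++ [false] := by
  simpa [codeBits] using codeBits_replicate_append n b []

theorem codeBinary_two_pow (e : ℕ) :
    codeBinary (2 ^ e) = rep e [true, false] ++ [true, true, false] := by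
  rw [codeBinary, encodeNat_two_pow, codeBits_replicate_append]
  rfl

theorem codeProg_withWord (p : StackProg) (w : List Bool) :
    codeProg (withWord p w) =
      (w.flatMap fun b => codeUnary 3 ++ codeProg (push 5 b)) ++ codeProg p := by
  induction w with
  | nil => rfl
  | cons b w ih => simp [withWord, codeProg, ih]

theorem codeBits_ofFn_lieType (m : ℕ) (g z : Bool) :
    codeBits (List.ofFn (lieType m g z).1) =
      [true, false, true, true, true, g] ++ rep m [true, false] ++ [false] := by
  simp [lieType, List.ofFn_succ, codeBits, codeBits_replicate]

/-- The code is brought into a form made of constants, unary numbers, repetitions and one `flatMap`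
over `w`, all of which are emittable. The input enters only through its length and the pushes at the
start of the program. -/
theorem code_auditInstance (p : StackProg) (w : List Bool) (m clock : ℕ) :
    (auditInstance p w m clock).code =
      codeUnary (m + 3) ++ codeUnary 1 ++
      ((w.flatMap fun b => codeUnary 3 ++ codeProg (push 5 b)) ++ codeProg (scoreProg p)) ++
      codeUnary clock ++ codeUnary 3 ++ codeBinary 1 ++
      (rep (m + 10) [true, false] ++ [true, true, false]) ++ codeBinary 1 ++ codeBinary 1 ++
      (([true, false, true, true, true, false] ++ rep m [true, false] ++ [false]) ++
        [true, true, false] ++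
        (([true, false, true, true, true, true] ++ rep m [true, false] ++ [false]) ++
        [true, true, false] ++
        ((rep (m + 3) [true, false] ++ [false]) ++ [true, false, false] ++
        ((rep (m + 3) [true, false] ++ [false]) ++ [true, false, false] ++ [])))) := by
  rw [← codeBinary_two_pow, ← codeProg_withWord, ← codeBits_ofFn_lieType m false true,
    ← codeBits_ofFn_lieType m true true, ← codeBits_replicate, ← List.ofFn_const]
  obtain ⟨h1, h2⟩ := num_den_inv_two_pow (m + 10)
  unfold AuditInstance.code
  simp only [auditInstance, h1, h2]
  rfl

theorem eval_le_eval (q : Polynomial ℕ) {a b : ℕ} (h : a ≤ b) : q.eval a ≤ q.eval b := by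
  induction q using Polynomial.induction_on' with
  | add p q hp hq => simpa using add_le_add hp hq
  | monomial n c => simpa using Nat.mul_le_mul_left c (Nat.pow_le_pow_left h n)

theorem emittable_code (p : StackProg) (P Q : Polynomial ℕ) :
    Emittable (fun w => (auditInstance p w (P.eval w.length) (Q.eval w.length)).code) := by
  simp only [code_auditInstance]
  have h3 : Emittable (fun w => codeUnary (P.eval w.length + 3)) := by
    simpa using emittable_codeUnary (P + 3)
  have r0 := emittable_rep P [true, false]
  have r3 : Emittable (fun w => rep (P.eval w.length + 3) [true, false]) := by
    simpa using emittable_rep (P + 3) [true, false]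
  have r10 : Emittable (fun w => rep (P.eval w.length + 10) [true, false]) := by
    simpa using emittable_rep (P + 10) [true, false]
  have c (l : List Bool) := emittable_const l
  have hw : Emittable (fun w => w.flatMap fun b => codeUnary 3 ++ codeProg (push 5 b)) :=
    Emittable.flatMap (F := fun b _ => codeUnary 3 ++ codeProg (push 5 b)) fun _ => c _
  exact ((((((((h3.append (c _)).append (hw.append (c _))).append (emittable_codeUnary Q)).append
    (c _)).append (c _)).append (r10.append (c _))).append (c _)).append (c _)).append
    (((((c _).append r0).append (c _)).append (c _)).append
    (((((c _).append r0).append (c _)).append (c _)).append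
    (((r3.append (c _)).append (c _)).append (((r3.append (c _)).append (c _)).append (c _)))))

theorem polyTimeDecidable_head : PolyTimeDecidable₂ fun _ y => y.head? != some true := by
  refine ⟨test 1 (push 0 false) (push 0 true) (push 0 true), 2, fun x y => ?_⟩
  refine ⟨2, by simp, ?_⟩
  match y with
  | [] => exact ⟨rfl, rfl⟩
  | true :: _ => exact ⟨rfl, rfl⟩
  | false :: _ => exact ⟨rfl, rfl⟩

theorem mainTheorem5 :
    ∃ (T : StackProg) (C : ℕ), (topKAuditProblem 4 T C).IsNPHard := by
  refine ⟨truthProg, 10, fun L hL => ?_⟩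
  obtain ⟨V, l, ⟨p, q, hp⟩, hL⟩ := hL
  -- Two bits for each of the `l + 1` symbols of a padded certificate. The next polynomial is the
  -- running time of the score program, in which the verifier's input has length at most `|w| + l`.
  let P : Polynomial ℕ := 2 * (l + 1)
  let Q : Polynomial ℕ := 20 * P + 9 * Polynomial.X + 3 * q.comp (Polynomial.X + l) + 70
  have hP (w : List Bool) : P.eval w.length = 2 * (l.eval w.length + 1) := by simp [P]
  have hans (w r : List Bool) (hr : r.length = P.eval w.length) :
      p.Answers [w, unpad (pairBits r)] (q.eval (w.length + l.eval w.length))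
        (V w (unpad (pairBits r))) := by
    obtain ⟨t, ht, h⟩ := hp w (unpad (pairBits r))
    refine ⟨t, ht.trans (eval_le_eval q ?_), h⟩
    have h1 := unpad_length_le (pairBits r)
    have h2 := pairBits_length_le r
    rw [hr, hP] at h2
    omega
  have hclock (w : List Bool) : 20 * P.eval w.length + 9 * w.length +
      3 * q.eval (w.length + l.eval w.length) + 70 ≤ Q.eval w.length := by
    simp [Q]
  refine ⟨fun w => auditInstance p w (P.eval w.length) (Q.eval w.length), _,
    (emittable_code p P Q).polyTimeComputable, polyTimeDecidable_head, fun w => ?_⟩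
  obtain ⟨h1, h2⟩ := auditInstance_isSolution (V := V w) (hans w) (hclock w)
    (by rw [hP]; omega)
  refine ⟨auditInstance_admissible (V := V w) (hans w) (hclock w), h1, fun y hy => ?_⟩
  rw [h2 y hy, hP, certCount_ne_zero_iff, hL]
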